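/- Let $G$ be an abelian group. A function $q\colon G\to M$ to an abelian group is \emph{quadratic} if $q(-a)=q(a)$ for all $a$ and $b_q(a,b)=q(a+b)-q(a)-q(b)$ is biadditive. Let $\gamma\colon G\to\Gamma(G)$ be the universal quadratic function (Whitehead's universal quadratic group): every quadratic $q\colon G\to M$ is $\Psi\circ\gamma$ for a unique homomorphism $\Psi\colon\Gamma(G)\to M$. Concretely, $\Gamma(G)$ is the quotient of the free abelian group on $G$ by the relations making $\gamma$ quadratic. Let $A(G,1)$ be the (non-normalized) bar complex of $G$, free abelian on the cells $[x_1,\dots,x_n]$ with $$\partial[x_1,\dots,x_n]=[x_2,\dots,x_n]+\sum_{0<i<n}(-1)^i[x_1,\dots,x_i+x_{i+1},\dots,x_n]+(-1)^n[x_1,\dots,x_{n-1}],$$ and with the signed shuffle product $*$; it is a differential graded ring. Let $A(G,2)$ be the Eilenberg--Mac Lane complex, i.e. the bar construction on $A(G,1)$: its group of $n$-chains is free abelian on the words $[a_1|\cdots|a_k]$ of cells $a_i$ of positive dimension $|a_i|$ with $\sum_i(|a_i|+1)=n+1$, and, with $\varepsilon_i=\sum_{j\le i}(|a_j|+1)$,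 $$d[a_1|\cdots|a_k]=\sum_i(-1)^{\varepsilon_{i-1}}[a_1|\cdots|\partial a_i|\cdots|a_k]-\sum_{i<k}(-1)^{\varepsilon_i}[a_1|\cdots|a_i*a_{i+1}|\cdots|a_k].$$ Put $(H_{2\text{-ab}})_n(G,\mathbb Z)=H_n(A(G,2))$, which is $H_{n+1}(K(G,2),\mathbb Z)$. Then there is an isomorphism, natural in the abelian group $G$, $$\Gamma(G)\;\cong\;(H_{2\text{-ab}})_3(G,\mathbb Z).$$ -/

import Mathlib

open CategoryTheory

universe u

noncomputable section

set_option linter.unusedSectionVars false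

namespace EilenbergMacLane

/-! ### Whitehead's universal quadratic group -/

section Gamma

variable {G H M : Type u} [AddCommGroup G] [AddCommGroup H] [AddCommGroup M]

/-- Quadratic functions between abelian groups: `q (-a) = q a`, and the associated map
`b_q a b = q (a + b) - q a - q b` (`QuadraticMap.polar q a b`) is biadditive. -/
structure IsQuadratic (q : G → M) : Prop where
  map_neg : ∀ a, q (-a) = q a
  polar_add_left : ∀ a a' b,
    QuadraticMap.polar q (a + a') b = QuadraticMap.polar q a b + QuadraticMap.polar q a' b
  polar_add_right : ∀ a b b',
    QuadraticMap.polar q a (b + b') = QuadraticMap.polar q a b + QuadraticMap.polar q a b'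

variable (G) in
/-- The elements of the free abelian group on `G` which have to vanish for
the tautological function from `G` to become quadratic. -/
def gammaRelators : Set (FreeAbelianGroup G) :=
  {r | ∃ a, r = FreeAbelianGroup.of (-a) - FreeAbelianGroup.of a} ∪
  {r | ∃ a a' b, r = QuadraticMap.polar FreeAbelianGroup.of (a + a') b -
      (QuadraticMap.polar FreeAbelianGroup.of a b +
        QuadraticMap.polar FreeAbelianGroup.of a' b)} ∪
  {r | ∃ a b b', r = QuadraticMap.polar FreeAbelianGroup.of a (b + b') -
      (QuadraticMap.polar FreeAbelianGroup.of a b +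
        QuadraticMap.polar FreeAbelianGroup.of a b')}

variable (G) in
/-- Whitehead's universal quadratic group `Γ(G)`. -/
abbrev Gamma : Type u := FreeAbelianGroup G ⧸ AddSubgroup.closure (gammaRelators G)

/-- The universal quadratic function `γ : G → Γ(G)`. -/
def gamma (a : G) : Gamma G :=
  QuotientAddGroup.mk' (AddSubgroup.closure (gammaRelators G)) (FreeAbelianGroup.of a)

lemma mk_eq_of_sub_mem {x y : FreeAbelianGroup G} (h : x - y ∈ gammaRelators G) :
    QuotientAddGroup.mk' (AddSubgroup.closure (gammaRelators G)) x =
      QuotientAddGroup.mk' (AddSubgroup.closure (gammaRelators G)) y := by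
  rw [← sub_eq_zero, ← map_sub]
  exact (QuotientAddGroup.eq_zero_iff _).2 (AddSubgroup.subset_closure h)

lemma polar_gamma (a b : G) : QuadraticMap.polar (gamma (G := G)) a b =
    QuotientAddGroup.mk' (AddSubgroup.closure (gammaRelators G))
      (QuadraticMap.polar FreeAbelianGroup.of a b) := by
  simp only [QuadraticMap.polar, gamma, map_sub]

theorem isQuadratic_gamma : IsQuadratic (gamma (G := G)) where
  map_neg a := mk_eq_of_sub_mem (Or.inl (Or.inl ⟨a, rfl⟩))
  polar_add_left a a' b := by
    simp only [polar_gamma, ← map_add]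
    exact mk_eq_of_sub_mem (Or.inl (Or.inr ⟨a, a', b, rfl⟩))
  polar_add_right a b b' := by
    simp only [polar_gamma, ← map_add]
    exact mk_eq_of_sub_mem (Or.inr ⟨a, b, b', rfl⟩)

lemma lift_polar (q : G → M) (a b : G) :
    FreeAbelianGroup.lift q (QuadraticMap.polar FreeAbelianGroup.of a b) =
      QuadraticMap.polar q a b := by
  simp [QuadraticMap.polar]

/-- The homomorphism `Γ(G) → M` induced by a quadratic function `G → M`. -/
def gammaLift (q : G → M) (hq : IsQuadratic q) : Gamma G →+ M :=
  QuotientAddGroup.lift _ (FreeAbelianGroup.lift q) (by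
    rw [AddSubgroup.closure_le]
    rintro r ((⟨a, rfl⟩ | ⟨a, a', b, rfl⟩) | ⟨a, b, b', rfl⟩)
    · simp [hq.map_neg]
    · simp [lift_polar, hq.polar_add_left]
    · simp [lift_polar, hq.polar_add_right])

@[simp] lemma gammaLift_gamma (q : G → M) (hq : IsQuadratic q) (a : G) :
    gammaLift q hq (gamma a) = q a := by
  simp [gammaLift, gamma]

lemma gamma_hom_ext {f g : Gamma G →+ M} (h : ∀ a, f (gamma a) = g (gamma a)) : f = g := by
  apply QuotientAddGroup.addMonoidHom_ext
  apply FreeAbelianGroup.lift_ext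
  exact h

/-- The universal property: `γ : G → Γ(G)` is the universal quadratic function on `G`. -/
theorem gamma_universal (q : G → M) (hq : IsQuadratic q) :
    ∃! f : Gamma G →+ M, ∀ a, f (gamma a) = q a :=
  ⟨gammaLift q hq, gammaLift_gamma q hq, fun _ hf =>
    gamma_hom_ext fun a => (hf a).trans (gammaLift_gamma q hq a).symm⟩

lemma IsQuadratic.comp_hom {q : H → M} (hq : IsQuadratic q) (f : G →+ H) :
    IsQuadratic (fun a => q (f a)) where
  map_neg a := by simp [hq.map_neg]
  polar_add_left a a' b := by
    simpa [QuadraticMap.polar] using hq.polar_add_left (f a) (f a') (f b)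
  polar_add_right a b b' := by
    simpa [QuadraticMap.polar] using hq.polar_add_right (f a) (f b) (f b')

/-- `Γ(f) : Γ(G) → Γ(H)`, determined by `Γ(f) (γ a) = γ (f a)`. -/
def gammaMap (f : G →+ H) : Gamma G →+ Gamma H :=
  gammaLift (fun a => gamma (f a)) (isQuadratic_gamma.comp_hom f)

@[simp] lemma gammaMap_gamma (f : G →+ H) (a : G) : gammaMap f (gamma a) = gamma (f a) :=
  gammaLift_gamma _ _ a

end Gamma

/-- Whitehead's functor `Γ` on abelian groups. -/
def gammaFunctor : AddCommGrpCat.{u} ⥤ AddCommGrpCat.{u} where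
  obj G := AddCommGrpCat.of (Gamma G)
  map f := AddCommGrpCat.ofHom (gammaMap f.hom)
  map_id G := by
    ext1
    exact gamma_hom_ext fun a => by simp
  map_comp f g := by
    ext1
    exact gamma_hom_ext fun a => by simp

/-! ### The bar complex `A(G,1)` with its shuffle product -/

section Bar

variable (G : Type u) [AddCommGroup G]

/-- `A(G,1)`: the free abelian group on the cells `[x₁, …, xₙ]`. -/
abbrev Bar : Type u := List G →₀ ℤ

/-- The free abelian group on the words `[a₁ | … | aₖ]` whose letters are cells of `A(G,1)`. -/
abbrev Words : Type u := List (List G) →₀ ℤ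

variable {G}

/-- The `ℤ`-linear map with prescribed values on a basis. -/
abbrev linExt {X N : Type u} [AddCommGroup N] (f : X → N) : (X →₀ ℤ) →ₗ[ℤ] N :=
  Finsupp.linearCombination ℤ f

/-- The bilinear map with prescribed values on bases. -/
abbrev bilinExt {X Y N : Type u} [AddCommGroup N] (f : X → Y → N) :
    (X →₀ ℤ) →ₗ[ℤ] (Y →₀ ℤ) →ₗ[ℤ] N :=
  Finsupp.linearCombination ℤ fun x => Finsupp.linearCombination ℤ (f x)

/-- The basis element given by a cell or a word. -/
def cell {X : Type u} (x : X) : X →₀ ℤ := Finsupp.single x 1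

/-- `[x₁, …, xₙ] ↦ [x, x₁, …, xₙ]`. -/
def push (x : G) : Bar G →ₗ[ℤ] Bar G := linExt fun l => cell (x :: l)

/-- The sign involution `[x₁, …, xₙ] ↦ (-1)ⁿ [x₁, …, xₙ]`. -/
def sgn : Bar G →ₗ[ℤ] Bar G := linExt fun l => (-1 : ℤ) ^ l.length • cell l

/-- `[x₁, x₂, …, xₙ] ↦ [x + x₁, x₂, …, xₙ]`, and `[] ↦ []`. -/
def mergeCell (x : G) : List G → List G
  | [] => []
  | y :: l => (x + y) :: l

/-- The faces of `[x₁, …, xₙ]` except the first one, with their signs: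
`∑_{0 < i < n} (-1)ⁱ [x₁, …, xᵢ + xᵢ₊₁, …, xₙ] + (-1)ⁿ [x₁, …, xₙ₋₁]`. -/
def tailFaces : List G → Bar G
  | [] => 0
  | x :: l => -cell (mergeCell x l) - push x (tailFaces l)

/-- The first face `[x₂, …, xₙ]` of `[x₁, …, xₙ]`. -/
def headFace : List G → Bar G
  | [] => 0
  | _ :: l => cell l

/-- The differential of `A(G,1)`: `∂[x₁, …, xₙ] = [x₂, …, xₙ]
+ ∑_{0 < i < n} (-1)ⁱ [x₁, …, xᵢ + xᵢ₊₁, …, xₙ] + (-1)ⁿ [x₁, …, xₙ₋₁]`. -/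
def barD : Bar G →ₗ[ℤ] Bar G := linExt fun l => headFace l + tailFaces l

/-- The signed sum of all shuffles of two cells. The first letter of a shuffle is
either the first letter of the first cell, or the first letter of the second cell, which then has
to be moved past the whole first cell. -/
def shuffleCell : List G → List G → Bar G
  | [], l => cell l
  | x :: a, [] => cell (x :: a)
  | x :: a, y :: b =>
      push x (shuffleCell a (y :: b)) +
        (-1 : ℤ) ^ (a.length + 1) • push y (shuffleCell (x :: a) b)
termination_by a b => a.length + b.length

/-- The shuffle product of `A(G,1)`. -/
def shuffle : Bar G →ₗ[ℤ] Bar G →ₗ[ℤ] Bar G := bilinExt shuffleCell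

/-! ### The bar construction on `A(G,1)` -/

/-- `(a, [a₁ | … | aₖ]) ↦ [a | a₁ | … | aₖ]`. -/
def pushWord : Bar G →ₗ[ℤ] Words G →ₗ[ℤ] Words G := bilinExt fun a w => cell (a :: w)

/-- `(a, [a₁ | a₂ | … | aₖ]) ↦ [a * a₁ | a₂ | … | aₖ]` with the shuffle product `*`;
the empty word is sent to zero. -/
def mulWord : Bar G →ₗ[ℤ] Words G →ₗ[ℤ] Words G := bilinExt fun a w =>
  match w with
  | [] => 0
  | b :: v => pushWord (shuffleCell a b) (cell v)

/-- The differential of the bar construction on a word. With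
`εᵢ = (|a₁| + 1) + ⋯ + (|aᵢ| + 1)` it is the sum of all
`(-1)^(εᵢ₋₁) [a₁ | … | ∂aᵢ | … | aₖ]` and all
`-(-1)^(εᵢ) [a₁ | … | aᵢ * aᵢ₊₁ | … | aₖ]`. -/
def wordD : List (List G) → Words G
  | [] => 0
  | a :: w => pushWord (barD (cell a)) (cell w) +
      (-1 : ℤ) ^ (a.length + 1) • (pushWord (cell a) (wordD w) - mulWord (cell a) (cell w))

/-- The differential of the bar construction. -/
def totalD : Words G →ₗ[ℤ] Words G := linExt wordD

/-- The degree `(|a₁| + 1) + ⋯ + (|aₖ| + 1)` of `[a₁ | … | aₖ]` in the bar construction. -/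
def wordDegree (w : List (List G)) : ℕ := (w.map fun a => a.length + 1).sum

variable (G) in
/-- The words `[a₁ | … | aₖ]` of degree `n` in the bar construction, whose letters are
cells `aᵢ = [xᵢ₁, …, xᵢₘ]` of positive degree. -/
def wordsOfDegree (n : ℕ) : Set (List (List G)) :=
  {w | (∀ a ∈ w, a ≠ []) ∧ wordDegree w = n}

variable (G) in
/-- The group of `n`-chains of `A(G,2)`. Degree `n` is degree `n + 1` of the bar construction,
as in `H^n_{2-ab}(G, M) = H^{n+1}(K(G,2), M)`: degree one is free on the cells `[x]`,
degree two on `[x, y]`, degree three on `[x, y, z]` and `[x] | [y]`. -/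
abbrev chains (n : ℕ) : Submodule ℤ (Words G) :=
  Finsupp.supported ℤ ℤ (wordsOfDegree G (n + 1))

/-! ### The differentials square to zero -/

section

variable {X Y Z N : Type u} [AddCommGroup N]

@[simp] lemma linExt_cell (f : X → N) (x : X) : linExt f (cell x) = f x := by simp [cell]

@[simp] lemma bilinExt_cell (f : X → Y → N) (x : X) : bilinExt f (cell x) = linExt (f x) := by
  simp [cell]

lemma hom_ext {f g : (X →₀ ℤ) →ₗ[ℤ] N} (h : ∀ x, f (cell x) = g (cell x)) (u : X →₀ ℤ) :
    f u = g u := by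
  have : f = g := by
    ext x : 2
    exact h x
  exact LinearMap.congr_fun this u

lemma hom_ext₂ {f g : (X →₀ ℤ) →ₗ[ℤ] (Y →₀ ℤ) →ₗ[ℤ] N}
    (h : ∀ x y, f (cell x) (cell y) = g (cell x) (cell y)) (u : X →₀ ℤ) (v : Y →₀ ℤ) :
    f u v = g u v := by
  refine hom_ext (f := f u) (g := g u) (fun y => ?_) v
  exact hom_ext (f := f.flip (cell y)) (g := g.flip (cell y)) (fun x => h x y) u

end

lemma push_cell (x : G) (l : List G) : push x (cell l) = cell (x :: l) := by simp [push]

@[simp] lemma sgn_nil : sgn (cell ([] : List G)) = cell [] := by simp [sgn]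

lemma sgn_cell (l : List G) : sgn (cell l) = (-1 : ℤ) ^ l.length • cell l := by simp [sgn]

@[simp] lemma sgn_push (x : G) (u : Bar G) : sgn (push x u) = -push x (sgn u) :=
  hom_ext (f := sgn ∘ₗ push x) (g := -(push x ∘ₗ sgn))
    (fun l => by simp [push_cell, sgn_cell, pow_succ]) u

@[simp] lemma sgn_sgn (u : Bar G) : sgn (sgn u) = u :=
  hom_ext (f := sgn ∘ₗ sgn) (g := LinearMap.id)
    (fun l => by simp [sgn_cell, smul_smul, ← mul_pow]) u

/-- The linear extension of `mergeCell`. -/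
def merge (x : G) : Bar G →ₗ[ℤ] Bar G := linExt fun l => cell (mergeCell x l)

/-- The linear extension of `tailFaces`. -/
def tailD : Bar G →ₗ[ℤ] Bar G := linExt tailFaces

/-- The linear extension of `headFace`. -/
def headD : Bar G →ₗ[ℤ] Bar G := linExt headFace

lemma barD_eq (u : Bar G) : barD u = headD u + tailD u :=
  hom_ext (f := barD) (g := headD + tailD) (fun l => by simp [barD, headD, tailD]) u

@[simp] lemma merge_nil (x : G) : merge x (cell []) = cell [] := by simp [merge, mergeCell]
@[simp] lemma tailD_nil : tailD (cell ([] : List G)) = 0 := by simp [tailD, tailFaces]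
@[simp] lemma headD_nil : headD (cell ([] : List G)) = 0 := by simp [headD, headFace]

@[simp] lemma merge_push (x y : G) (u : Bar G) : merge x (push y u) = push (x + y) u :=
  hom_ext (f := merge x ∘ₗ push y) (fun l => by simp [push_cell, merge, mergeCell]) u

@[simp] lemma tailD_push (x : G) (u : Bar G) :
    tailD (push x u) = -merge x u - push x (tailD u) :=
  hom_ext (f := tailD ∘ₗ push x) (g := -merge x - push x ∘ₗ tailD)
    (fun l => by simp [push_cell, merge, tailD, tailFaces]) u

@[simp] lemma headD_push (x : G) (u : Bar G) : headD (push x u) = u :=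
  hom_ext (f := headD ∘ₗ push x) (g := LinearMap.id)
    (fun l => by simp [push_cell, headD, headFace]) u

/-- Linear maps on `A(G,1)` agree if they agree on cells. -/
lemma bar_ext {N : Type u} [AddCommGroup N] {f g : Bar G →ₗ[ℤ] N}
    (h₀ : f (cell []) = g (cell [])) (h : ∀ x l, f (push x (cell l)) = g (push x (cell l)))
    (u : Bar G) : f u = g u := by
  refine hom_ext (fun l => ?_) u
  cases l with
  | nil => exact h₀
  | cons x l => simpa [push_cell] using h x l

lemma bar_rec {N : Type u} [AddCommGroup N] {f g : Bar G →ₗ[ℤ] N}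
    (h₀ : f (cell []) = g (cell []))
    (h : ∀ x l, f (cell l) = g (cell l) → f (push x (cell l)) = g (push x (cell l)))
    (u : Bar G) : f u = g u := by
  refine hom_ext (fun l => ?_) u
  induction l with
  | nil => exact h₀
  | cons x l ih => simpa [push_cell] using h x l ih

lemma merge_merge (x y : G) (u : Bar G) : merge x (merge y u) = merge (x + y) u :=
  bar_ext (f := merge x ∘ₗ merge y) (by simp) (by simp [add_assoc]) u

lemma tailD_merge (x : G) (u : Bar G) : tailD (merge x u) = merge x (tailD u) :=
  bar_ext (f := tailD ∘ₗ merge x) (g := merge x ∘ₗ tailD) (by simp) (by simp [merge_merge]) u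

lemma headD_merge (x : G) (u : Bar G) : headD (merge x u) = headD u :=
  bar_ext (f := headD ∘ₗ merge x) (by simp) (by simp) u

lemma sgn_merge (x : G) (u : Bar G) : sgn (merge x u) = merge x (sgn u) :=
  bar_ext (f := sgn ∘ₗ merge x) (g := merge x ∘ₗ sgn) (by simp) (by simp) u

lemma tailD_tailD (u : Bar G) : tailD (tailD u) = 0 := by
  have h := bar_rec (f := tailD ∘ₗ tailD) (g := 0) (by simp)
    (fun x l ih => by simp_all [tailD_merge]) u
  simpa only [LinearMap.comp_apply, LinearMap.zero_apply] using h

lemma barD_barD (u : Bar G) : barD (barD u) = 0 := by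
  have h := bar_ext (f := barD ∘ₗ barD) (g := 0) (by simp [barD_eq])
    (fun x l => by simp [barD_eq, headD_merge, tailD_merge, tailD_tailD]; abel) u
  simpa only [LinearMap.comp_apply, LinearMap.zero_apply] using h

lemma tailD_sgn (u : Bar G) : tailD (sgn u) = -sgn (tailD u) := by
  have h := bar_rec (f := tailD ∘ₗ sgn) (g := -(sgn ∘ₗ tailD)) (by simp)
    (fun x l ih => by
      simp only [LinearMap.comp_apply, LinearMap.neg_apply] at ih ⊢
      simp only [sgn_push, map_neg, tailD_push, ih, map_sub, sgn_merge]) u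
  simpa only [LinearMap.comp_apply, LinearMap.neg_apply] using h

lemma headD_sgn (u : Bar G) : headD (sgn u) = -sgn (headD u) := by
  have h := bar_ext (f := headD ∘ₗ sgn) (g := -(sgn ∘ₗ headD)) (by simp) (by simp) u
  simpa only [LinearMap.comp_apply, LinearMap.neg_apply] using h

lemma barD_sgn (u : Bar G) : barD (sgn u) = -sgn (barD u) := by
  simp only [barD_eq, headD_sgn, tailD_sgn, map_add, neg_add]

@[simp] lemma shuffle_nil_left (v : Bar G) : shuffle (cell []) v = v :=
  hom_ext (f := shuffle (cell [])) (g := LinearMap.id) (fun l => by simp [shuffle, shuffleCell]) v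

@[simp] lemma shuffle_nil_right (u : Bar G) : shuffle u (cell []) = u :=
  bar_ext (f := shuffle.flip (cell [])) (g := LinearMap.id) (by simp)
    (by simp [push_cell, shuffle, shuffleCell]) u

lemma shuffle_push_push (x y : G) (u v : Bar G) :
    shuffle (push x u) (push y v) =
      push x (shuffle u (push y v)) - push y (shuffle (push x (sgn u)) v) := by
  refine hom_ext₂ (f := shuffle.compl₁₂ (push x) (push y))
    (g := (shuffle.compl₁₂ LinearMap.id (push y)).compr₂ (push x) -
        (shuffle.compl₁₂ (push x ∘ₗ sgn) LinearMap.id).compr₂ (push y)) (fun a b => ?_) u v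
  have h : shuffle (cell (x :: a)) (cell b) = shuffleCell (x :: a) b := by simp [shuffle]
  have h' : shuffle (cell a) (cell (y :: b)) = shuffleCell a (y :: b) := by simp [shuffle]
  have h'' : shuffle (cell (x :: a)) (cell (y :: b)) = shuffleCell (x :: a) (y :: b) := by
    simp [shuffle]
  simp only [LinearMap.compl₁₂_apply, LinearMap.sub_apply, LinearMap.compr₂_apply,
    LinearMap.comp_apply, LinearMap.id_apply, push_cell, sgn_cell, map_smul,
    LinearMap.smul_apply, h, h', h'']
  rw [shuffleCell, pow_succ, mul_neg_one, neg_smul, sub_eq_add_neg]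

lemma shuffle_push_nil_push (x y : G) (v : Bar G) :
    shuffle (push x (cell [])) (push y v) =
      push x (push y v) - push y (shuffle (push x (cell [])) v) := by
  simp [shuffle_push_push]

lemma merge_shuffle (x y : G) (a b : List G) :
    merge x (shuffle (cell a) (push y (cell b))) -
      merge y (shuffle (push x (sgn (cell a))) (cell b)) =
    shuffle (merge x (cell a)) (push y (cell b)) -
      shuffle (push x (sgn (cell a))) (merge y (cell b)) +
      push x (shuffle (sgn (cell a)) (merge y (cell b))) -
      push y (shuffle (sgn (merge x (cell a))) (cell b)) := by
  cases a with
  | nil =>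
    cases b with
    | nil => simp [add_comm y x]
    | cons w b =>
      rw [← push_cell w b]
      simp only [shuffle_nil_left, sgn_nil, merge_nil, merge_push, shuffle_push_nil_push,
        map_sub, add_comm y x]
      abel
  | cons z a =>
    rw [← push_cell z a]
    cases b with
    | nil =>
      simp only [shuffle_push_push, shuffle_nil_right, sgn_push, merge_nil, merge_push,
        map_sub, map_neg, LinearMap.neg_apply, add_comm y x]
      abel
    | cons w b =>
      rw [← push_cell w b]
      simp only [shuffle_push_push, sgn_push, merge_push, map_sub, map_neg,
        LinearMap.neg_apply, add_comm y x, sgn_sgn]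
      abel

lemma push_sgn_cell (x : G) (a : List G) :
    push x (sgn (cell a)) = (-1 : ℤ) ^ a.length • cell (x :: a) := by
  simp [sgn_cell, push_cell]

lemma push_eq_smul (x : G) (a : List G) :
    push x (cell a) = -((-1 : ℤ) ^ a.length • sgn (cell (x :: a))) := by
  rw [← map_smul, ← push_sgn_cell, sgn_push, sgn_sgn, neg_neg]

lemma tailD_shuffle_cell (a b : List G) :
    tailD (shuffle (cell a) (cell b)) =
      shuffle (tailD (cell a)) (cell b) + shuffle (sgn (cell a)) (tailD (cell b)) := by
  induction a generalizing b with
  | nil => simp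
  | cons x a iha =>
    induction b with
    | nil => simp
    | cons y b ihb =>
      have h₁ := iha (y :: b)
      have h₂ : tailD (shuffle (push x (sgn (cell a))) (cell b)) =
          shuffle (tailD (push x (sgn (cell a)))) (cell b) -
            shuffle (push x (cell a)) (tailD (cell b)) := by
        rw [push_eq_smul, push_sgn_cell]
        simp only [map_smul, LinearMap.smul_apply, ihb, smul_add, map_neg, LinearMap.neg_apply,
          sub_neg_eq_add]
      have h₃ := merge_shuffle x y a b
      rw [← push_cell] at h₁
      rw [← push_cell x a, ← push_cell y b]
      simp only [shuffle_push_push, map_sub, tailD_push, h₁, h₂, sgn_push, map_neg,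
        LinearMap.sub_apply, LinearMap.neg_apply, tailD_sgn, sgn_sgn, sgn_merge] at h₃ ⊢
      rw [← sub_eq_zero] at h₃ ⊢
      rw [← neg_eq_zero, ← h₃]
      simp only [map_add, map_sub, map_neg]
      abel

lemma headD_shuffle_cell (a b : List G) :
    headD (shuffle (cell a) (cell b)) =
      shuffle (headD (cell a)) (cell b) + shuffle (sgn (cell a)) (headD (cell b)) := by
  cases a with
  | nil => simp
  | cons x a =>
    cases b with
    | nil => simp
    | cons y b =>
      rw [← push_cell x a, ← push_cell y b]
      simp [shuffle_push_push, sub_eq_add_neg]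

/-- The differential of `A(G,1)` is a derivation for the shuffle product. -/
lemma barD_shuffle (u v : Bar G) :
    barD (shuffle u v) = shuffle (barD u) v + shuffle (sgn u) (barD v) := by
  refine hom_ext₂ (f := shuffle.compr₂ barD)
    (g := shuffle.compl₁₂ barD LinearMap.id + shuffle.compl₁₂ sgn barD) (fun a b => ?_) u v
  simp only [LinearMap.compr₂_apply, LinearMap.add_apply, LinearMap.compl₁₂_apply,
    LinearMap.id_apply, barD_eq, headD_shuffle_cell, tailD_shuffle_cell, map_add]
  abel

lemma sgn_shuffle_cell (a b : List G) :
    sgn (shuffle (cell a) (cell b)) = shuffle (sgn (cell a)) (sgn (cell b)) := by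
  induction a generalizing b with
  | nil => simp
  | cons x a iha =>
    induction b with
    | nil => simp
    | cons y b ihb =>
      have h₁ := iha (y :: b)
      have h₂ : sgn (shuffle (push x (sgn (cell a))) (cell b)) =
          -shuffle (push x (cell a)) (sgn (cell b)) := by
        rw [push_eq_smul, push_sgn_cell]
        simp only [map_smul, LinearMap.smul_apply, ihb, map_neg, LinearMap.neg_apply, neg_neg]
      rw [← push_cell] at h₁
      rw [← push_cell x a, ← push_cell y b]
      simp only [shuffle_push_push, map_sub, map_neg, sgn_push, h₁, h₂,
        LinearMap.neg_apply, sgn_sgn]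
      abel

lemma sgn_shuffle (u v : Bar G) : sgn (shuffle u v) = shuffle (sgn u) (sgn v) :=
  hom_ext₂ (f := shuffle.compr₂ sgn) (g := shuffle.compl₁₂ sgn sgn)
    (fun a b => by simpa using sgn_shuffle_cell a b) u v

lemma shuffle_assoc_cell (a b c : List G) :
    shuffle (shuffle (cell a) (cell b)) (cell c) =
      shuffle (cell a) (shuffle (cell b) (cell c)) := by
  induction a generalizing b c with
  | nil => simp
  | cons x a iha =>
    induction b generalizing c with
    | nil => simp
    | cons y b ihb =>
      induction c with
      | nil => simp
      | cons z c ihc =>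
        have h₁ := iha (y :: b) (z :: c)
        have h₂ : shuffle (shuffle (push x (sgn (cell a))) (cell b)) (push z (cell c)) =
            shuffle (push x (sgn (cell a))) (shuffle (cell b) (push z (cell c))) := by
          rw [push_sgn_cell, push_cell z]
          simp only [map_smul, LinearMap.smul_apply, ihb]
        have h₃ : shuffle (shuffle (push x (sgn (cell a))) (push y (sgn (cell b)))) (cell c) =
            shuffle (push x (sgn (cell a))) (shuffle (push y (sgn (cell b))) (cell c)) := by
          rw [push_sgn_cell, push_sgn_cell]
          simp only [map_smul, LinearMap.smul_apply, ihc]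
        rw [← push_cell, ← push_cell] at h₁
        rw [← push_cell x a, ← push_cell y b, ← push_cell z c]
        have e₁ := shuffle_push_push x y (sgn (cell a)) (sgn (cell b))
        have s₁ := sgn_shuffle_cell a (y :: b)
        have s₂ := sgn_shuffle (push x (sgn (cell a))) (cell b)
        rw [← push_cell] at s₁
        simp only [sgn_push, sgn_sgn, map_neg, LinearMap.neg_apply] at s₁ s₂ e₁
        simp only [shuffle_push_push x y, shuffle_push_push y z, map_sub, LinearMap.sub_apply]
        rw [shuffle_push_push x z, shuffle_push_push x z, h₁, h₂, s₁, s₂]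
        simp only [shuffle_push_push y z, map_sub, map_neg, LinearMap.neg_apply]
        rw [← h₃, e₁]
        simp only [map_sub, LinearMap.sub_apply]
        abel

lemma shuffle_assoc (u v w : Bar G) : shuffle (shuffle u v) w = shuffle u (shuffle v w) := by
  refine hom_ext (f := shuffle (shuffle u v)) (g := shuffle u ∘ₗ shuffle v) (fun c => ?_) w
  exact hom_ext₂ (f := shuffle.compr₂ (shuffle.flip (cell c)))
    (g := shuffle.compl₁₂ LinearMap.id (shuffle.flip (cell c)))
    (fun a b => shuffle_assoc_cell a b c) u v

@[simp] lemma pushWord_cell (a : List G) (w : List (List G)) :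
    pushWord (cell a) (cell w) = cell (a :: w) := by simp [pushWord]

@[simp] lemma mulWord_nil (u : Bar G) : mulWord u (cell []) = 0 :=
  hom_ext (f := mulWord.flip (cell [])) (g := 0) (fun a => by simp [mulWord]) u

@[simp] lemma mulWord_pushWord (u v : Bar G) (W : Words G) :
    mulWord u (pushWord v W) = pushWord (shuffle u v) W := by
  refine hom_ext (f := mulWord u ∘ₗ pushWord v) (g := pushWord (shuffle u v)) (fun w => ?_) W
  refine hom_ext₂ (f := mulWord.compl₁₂ LinearMap.id (pushWord.flip (cell w)))
    (g := shuffle.compr₂ (pushWord.flip (cell w))) (fun a b => ?_) u v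
  simp [mulWord, shuffle]

@[simp] lemma totalD_nil : totalD (cell ([] : List (List G))) = 0 := by simp [totalD, wordD]

lemma totalD_pushWord (u : Bar G) (W : Words G) :
    totalD (pushWord u W) =
      pushWord (barD u) W - pushWord (sgn u) (totalD W) + mulWord (sgn u) W := by
  refine hom_ext₂ (f := pushWord.compr₂ totalD)
    (g := pushWord ∘ₗ barD - pushWord.compl₁₂ sgn totalD + mulWord ∘ₗ sgn) (fun a w => ?_) u W
  simp only [LinearMap.compr₂_apply, LinearMap.add_apply, LinearMap.compl₁₂_apply,
    LinearMap.sub_apply, LinearMap.comp_apply, pushWord_cell, sgn_cell]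
  simp only [totalD, linExt_cell, wordD, pow_succ, map_smul, LinearMap.smul_apply,
    mul_neg, mul_one, neg_smul, smul_sub]
  abel

lemma mulWord_mulWord (u v : Bar G) (W : Words G) :
    mulWord u (mulWord v W) = mulWord (shuffle u v) W := by
  refine hom_ext (f := mulWord u ∘ₗ mulWord v) (g := mulWord (shuffle u v)) (fun w => ?_) W
  cases w with
  | nil => simp
  | cons b w => simp [← pushWord_cell, shuffle_assoc]

lemma totalD_mulWord (u : Bar G) (W : Words G) :
    totalD (mulWord u W) = mulWord (barD u) W + mulWord (sgn u) (totalD W) := by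
  refine hom_ext (f := totalD ∘ₗ mulWord u)
    (g := mulWord (barD u) + mulWord (sgn u) ∘ₗ totalD) (fun w => ?_) W
  cases w with
  | nil => simp
  | cons b w =>
    simp only [LinearMap.comp_apply, LinearMap.add_apply, ← pushWord_cell, mulWord_pushWord,
      totalD_pushWord, barD_shuffle, sgn_shuffle, map_add, map_sub, mulWord_mulWord]
    abel

/-- The differential of the bar construction squares to zero. -/
lemma totalD_totalD (W : Words G) : totalD (totalD W) = 0 := by
  suffices h : totalD ∘ₗ totalD = (0 : Words G →ₗ[ℤ] Words G) by
    simpa only [LinearMap.comp_apply, LinearMap.zero_apply] using LinearMap.congr_fun h W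
  refine LinearMap.ext (hom_ext fun w => ?_)
  induction w with
  | nil => simp
  | cons a w ih =>
    simp only [LinearMap.comp_apply, LinearMap.zero_apply] at ih ⊢
    rw [← pushWord_cell]
    simp only [totalD_pushWord, map_add, map_sub, totalD_mulWord, barD_barD, ih, barD_sgn,
      map_neg, map_zero, LinearMap.neg_apply, LinearMap.zero_apply, sgn_sgn]
    abel

/-! ### The complex `A(G,2)` -/

section

variable {X Y N : Type u}

lemma cell_mem {s : Set X} {x : X} (h : x ∈ s) : cell x ∈ Finsupp.supported ℤ ℤ s :=
  Finsupp.single_mem_supported ℤ 1 h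

lemma map_mem {s : Set X} {t : Set Y} (f : (X →₀ ℤ) →ₗ[ℤ] (Y →₀ ℤ))
    (h : ∀ x ∈ s, f (cell x) ∈ Finsupp.supported ℤ ℤ t) {u : X →₀ ℤ}
    (hu : u ∈ Finsupp.supported ℤ ℤ s) : f u ∈ Finsupp.supported ℤ ℤ t := by
  have : Finsupp.supported ℤ ℤ s ≤ (Finsupp.supported ℤ ℤ t).comap f := by
    rw [Finsupp.supported_eq_span_single, Submodule.span_le]
    rintro _ ⟨x, hx, rfl⟩
    exact h x hx
  exact this hu

end

lemma push_mem (x : G) {n : ℕ} {u : Bar G}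
    (hu : u ∈ Finsupp.supported ℤ ℤ {l : List G | l.length = n}) :
    push x u ∈ Finsupp.supported ℤ ℤ {l : List G | l.length = n + 1} := by
  refine map_mem (push x) (fun l hl => ?_) hu
  rw [push_cell]
  exact cell_mem (by simpa using hl)

lemma tailFaces_mem (x : G) (l : List G) :
    tailFaces (x :: l) ∈ Finsupp.supported ℤ ℤ {a : List G | a.length = l.length} := by
  induction l generalizing x with
  | nil =>
    simp only [tailFaces, mergeCell, map_zero, sub_zero]
    exact neg_mem (cell_mem rfl)
  | cons y l ih =>
    rw [tailFaces]
    exact sub_mem (neg_mem (cell_mem (by simp [mergeCell]))) (push_mem x (ih y))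

lemma barD_mem (x : G) (l : List G) :
    barD (cell (x :: l)) ∈ Finsupp.supported ℤ ℤ {a : List G | a.length = l.length ∧ a ≠ []} := by
  cases l with
  | nil => simp [barD, headFace, tailFaces, mergeCell]
  | cons y l =>
    have : barD (cell (x :: y :: l)) ∈
        Finsupp.supported ℤ ℤ {a : List G | a.length = (y :: l).length} := by
      simp only [barD, linExt_cell]
      exact add_mem (cell_mem rfl) (tailFaces_mem x (y :: l))
    refine Finsupp.supported_mono ?_ this
    rintro (_ | ⟨z, a⟩) h
    · simp at h
    · exact ⟨h, by simp⟩

lemma shuffleCell_mem (a b : List G) :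
    shuffleCell a b ∈ Finsupp.supported ℤ ℤ {c : List G | c.length = a.length + b.length} := by
  induction a generalizing b with
  | nil => rw [shuffleCell]; exact cell_mem (by simp)
  | cons x a iha =>
    induction b with
    | nil => rw [shuffleCell]; exact cell_mem (by simp)
    | cons y b ihb =>
      rw [shuffleCell]
      refine add_mem ?_ (Submodule.smul_mem _ _ ?_)
      · have := push_mem x (iha (y :: b))
        rwa [show a.length + (y :: b).length + 1 = (x :: a).length + (y :: b).length by
          simp only [List.length_cons]; omega] at this
      · exact push_mem y ihb

lemma pushWord_mem {m k : ℕ} {u : Bar G} {W : Words G}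
    (hu : u ∈ Finsupp.supported ℤ ℤ {a : List G | a.length = m ∧ a ≠ []})
    (hW : W ∈ Finsupp.supported ℤ ℤ (wordsOfDegree G k)) :
    pushWord u W ∈ Finsupp.supported ℤ ℤ (wordsOfDegree G (m + 1 + k)) := by
  refine map_mem (pushWord u) (fun w hw => ?_) hW
  refine map_mem (pushWord.flip (cell w)) (fun a ha => ?_) hu
  rw [LinearMap.flip_apply, pushWord_cell]
  refine cell_mem ⟨?_, ?_⟩
  · simpa using ⟨ha.2, hw.1⟩
  · have h := hw.2
    simp only [wordDegree, List.map_cons, List.sum_cons] at h ⊢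
    rw [ha.1, h]

lemma wordD_mem (w : List (List G)) (k : ℕ) (hw : w ∈ wordsOfDegree G (k + 1)) :
    wordD w ∈ Finsupp.supported ℤ ℤ (wordsOfDegree G k) := by
  induction w generalizing k with
  | nil => simp [wordD]
  | cons a w ih =>
    obtain ⟨h₁, h₂⟩ := hw
    have ha : a ≠ [] := h₁ a (by simp)
    have hw : w ∈ wordsOfDegree G (wordDegree w) := ⟨fun b hb => h₁ b (by simp [hb]), rfl⟩
    have hk : a.length + wordDegree w = k := by
      simp only [wordDegree, List.map_cons, List.sum_cons] at h₂ ⊢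
      omega
    rw [wordD]
    refine add_mem ?_ (Submodule.smul_mem _ _ (sub_mem ?_ ?_))
    · obtain ⟨x, l, rfl⟩ := List.exists_cons_of_ne_nil ha
      have := pushWord_mem (barD_mem x l) (cell_mem hw)
      rwa [← List.length_cons (a := x), hk] at this
    · have ha' : cell a ∈ Finsupp.supported ℤ ℤ {b : List G | b.length = a.length ∧ b ≠ []} :=
        cell_mem ⟨rfl, ha⟩
      cases w with
      | nil => simp [wordD]
      | cons b v =>
        have hd : wordDegree (b :: v) = (b.length + wordDegree v) + 1 := by
          simp only [wordDegree, List.map_cons, List.sum_cons]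
          omega
        have := pushWord_mem ha' (ih _ (hd ▸ hw))
        rwa [show a.length + 1 + (b.length + wordDegree v) = k by omega] at this
    · cases w with
      | nil => simp
      | cons b v =>
        have hb : b ≠ [] := h₁ b (by simp)
        have hv : v ∈ wordsOfDegree G (wordDegree v) :=
          ⟨fun c hc => h₁ c (by simp [hc]), rfl⟩
        have hd : wordDegree (b :: v) = (b.length + wordDegree v) + 1 := by
          simp only [wordDegree, List.map_cons, List.sum_cons]
          omega
        have hs : shuffleCell a b ∈ Finsupp.supported ℤ ℤ
            {c : List G | c.length = a.length + b.length ∧ c ≠ []} := by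
          refine Finsupp.supported_mono ?_ (shuffleCell_mem a b)
          intro c hc
          refine ⟨hc, ?_⟩
          rintro rfl
          have := List.length_pos_of_ne_nil ha
          simp only [Set.mem_ofPred_eq, List.length_nil] at hc
          omega
        have := pushWord_mem hs (cell_mem hv)
        rw [show a.length + b.length + 1 + wordDegree v = k by omega] at this
        simpa [mulWord] using this

lemma totalD_mem {n : ℕ} {W : Words G} (hW : W ∈ chains G (n + 1)) : totalD W ∈ chains G n :=
  map_mem totalD (fun w hw => by simpa [totalD] using wordD_mem w _ hw) hW

variable (G) in
/-- The differential `A(G,2)ₙ₊₁ → A(G,2)ₙ`. -/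
def chainsD (n : ℕ) : chains G (n + 1) →ₗ[ℤ] chains G n :=
  totalD.restrict fun _ => totalD_mem

lemma chainsD_chainsD (n : ℕ) (W : chains G (n + 1 + 1)) : chainsD G n (chainsD G (n + 1) W) = 0 :=
  Subtype.ext (totalD_totalD W.1)

variable {H K : Type u} [AddCommGroup H] [AddCommGroup K]

/-- The map induced by a homomorphism `f`, which applies `f` to all entries of a word. -/
def wordsMap (f : G →+ H) : Words G →ₗ[ℤ] Words H :=
  linExt fun w => cell (w.map (List.map f))

/-- The map `[x₁, …, xₙ] ↦ [f x₁, …, f xₙ]`. -/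
def barMap (f : G →+ H) : Bar G →ₗ[ℤ] Bar H := linExt fun l => cell (l.map f)

@[simp] lemma wordsMap_cell (f : G →+ H) (w : List (List G)) :
    wordsMap f (cell w) = cell (w.map (List.map f)) := by simp [wordsMap]

@[simp] lemma barMap_cell (f : G →+ H) (l : List G) :
    barMap f (cell l) = cell (l.map f) := by simp [barMap]

lemma barMap_push (f : G →+ H) (x : G) (u : Bar G) :
    barMap f (push x u) = push (f x) (barMap f u) :=
  hom_ext (f := barMap f ∘ₗ push x) (g := push (f x) ∘ₗ barMap f) (by simp [push_cell]) u

lemma barMap_tailFaces (f : G →+ H) (l : List G) :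
    barMap f (tailFaces l) = tailFaces (l.map f) := by
  induction l with
  | nil => simp [tailFaces]
  | cons x l ih =>
    simp only [tailFaces, List.map_cons, map_sub, map_neg, barMap_push, ih, barMap_cell]
    cases l <;> simp [mergeCell]

lemma barMap_barD (f : G →+ H) (l : List G) :
    barMap f (barD (cell l)) = barD (cell (l.map f)) := by
  simp only [barD, linExt_cell, map_add, barMap_tailFaces]
  cases l <;> simp [headFace]

lemma barMap_shuffleCell (f : G →+ H) (a b : List G) :
    barMap f (shuffleCell a b) = shuffleCell (a.map f) (b.map f) := by
  induction a generalizing b with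
  | nil => simp [shuffleCell]
  | cons x a iha =>
    induction b with
    | nil => simp [shuffleCell]
    | cons y b ihb =>
      have h := iha (y :: b)
      rw [List.map_cons] at ihb h
      rw [List.map_cons, List.map_cons, shuffleCell, shuffleCell, map_add, map_smul, barMap_push,
        barMap_push, h, ihb, List.length_map]

lemma wordsMap_pushWord (f : G →+ H) (u : Bar G) (W : Words G) :
    wordsMap f (pushWord u W) = pushWord (barMap f u) (wordsMap f W) :=
  hom_ext₂ (f := pushWord.compr₂ (wordsMap f))
    (g := pushWord.compl₁₂ (barMap f) (wordsMap f)) (by simp) u W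

lemma wordsMap_wordD (f : G →+ H) (w : List (List G)) :
    wordsMap f (wordD w) = wordD (w.map (List.map f)) := by
  induction w with
  | nil => simp [wordD]
  | cons a w ih =>
    have h : wordsMap f (mulWord (cell a) (cell w)) =
        mulWord (cell (a.map f)) (cell (w.map (List.map f))) := by
      cases w with
      | nil => simp
      | cons b v =>
        simp only [mulWord, List.map_cons, linExt_cell, wordsMap_pushWord,
          barMap_shuffleCell, wordsMap_cell]
    simp only [wordD, List.map_cons, map_add, map_smul, map_sub, wordsMap_pushWord,
      barMap_barD, ih, h, barMap_cell, wordsMap_cell, List.length_map]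

lemma wordsMap_totalD (f : G →+ H) (W : Words G) :
    wordsMap f (totalD W) = totalD (wordsMap f W) :=
  hom_ext (f := wordsMap f ∘ₗ totalD) (g := totalD ∘ₗ wordsMap f)
    (fun w => by simp [totalD, wordsMap_wordD]) W

lemma wordsMap_mem (f : G →+ H) {n : ℕ} {W : Words G} (hW : W ∈ chains G n) :
    wordsMap f W ∈ chains H n := by
  refine map_mem (wordsMap f) (fun w hw => ?_) hW
  rw [wordsMap_cell]
  refine cell_mem ⟨?_, ?_⟩
  · rintro a ha
    obtain ⟨b, hb, rfl⟩ := List.mem_map.1 ha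
    simpa using hw.1 b hb
  · rw [← hw.2]
    simp [wordDegree, Function.comp_def]

lemma wordsMap_id (W : Words G) : wordsMap (AddMonoidHom.id G) W = W :=
  hom_ext (f := wordsMap (AddMonoidHom.id G)) (g := LinearMap.id) (by simp) W

lemma wordsMap_comp (g : H →+ K) (f : G →+ H) (W : Words G) :
    wordsMap (g.comp f) W = wordsMap g (wordsMap f W) :=
  hom_ext (f := wordsMap (g.comp f)) (g := wordsMap g ∘ₗ wordsMap f)
    (fun w => by simp [Function.comp_def]) W

/-- The map induced by a homomorphism on `n`-chains. -/
def chainsMap (f : G →+ H) (n : ℕ) : chains G n →ₗ[ℤ] chains H n :=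
  (wordsMap f).restrict fun _ => wordsMap_mem f

end Bar

/-- The Eilenberg–Mac Lane complex `A(G,2)`: the bar construction on `A(G,1)`. -/
def complexA2 (G : AddCommGrpCat.{u}) : ChainComplex AddCommGrpCat.{u} ℕ :=
  ChainComplex.of (fun n => AddCommGrpCat.of (chains G n))
    (fun n => AddCommGrpCat.ofHom (chainsD G n).toAddMonoidHom)
    (fun n => by
      ext W : 2
      exact chainsD_chainsD n W)

lemma complexA2_d (G : AddCommGrpCat.{u}) (n : ℕ) : (complexA2 G).d (n + 1) n =
    AddCommGrpCat.ofHom (chainsD G n).toAddMonoidHom :=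
  ChainComplex.of_d (fun n => AddCommGrpCat.of (chains G n))
    (fun n => AddCommGrpCat.ofHom (chainsD G n).toAddMonoidHom) n

/-- The functor `G ↦ A(G,2)`. -/
def functorA2 : AddCommGrpCat.{u} ⥤ ChainComplex AddCommGrpCat.{u} ℕ where
  obj := complexA2
  map {G H} f := ChainComplex.ofHom
    (fun n => AddCommGrpCat.ofHom (chainsMap f.hom n).toAddMonoidHom)
    (fun n => by
      rw [complexA2_d, complexA2_d]
      ext W : 2
      exact Subtype.ext (wordsMap_totalD f.hom W.1).symm)
  map_id G := by
    ext n W : 3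
    exact Subtype.ext (wordsMap_id W.1)
  map_comp {G H K} f g := by
    ext n W : 3
    exact Subtype.ext (wordsMap_comp g.hom f.hom W.1)

/-- The homology functor `G ↦ (H_{2-ab})ₙ(G, ℤ) = Hₙ(A(G,2))`. -/
def homology2ab (n : ℕ) : AddCommGrpCat.{u} ⥤ AddCommGrpCat.{u} :=
  functorA2 ⋙ HomologicalComplex.homologyFunctor AddCommGrpCat.{u} (ComplexShape.down ℕ) n

end EilenbergMacLane

end

/-! The comparison map sends `γ x` to the class of the cycle `[x] | [x]`. Everything is tested on
characters with values in `ℚ/ℤ`, which separate points and extend from subgroups. In this way a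
character of `H₃` becomes a cochain of degree three that kills boundaries, and such a cochain is
exactly an abelian cocycle `(h, c)` in the sense of Eilenberg and Mac Lane: `h` is its value on `[x,
y, z]`, `c` its value on `[x] | [y]`, and the pentagon and the two hexagons express vanishing on the
boundaries of the three kinds of words one degree up. Under this dictionary the comparison map is
dual to the trace `(h, c) ↦ (x ↦ c x x)`, so three facts about traces suffice.

The trace is quadratic (`polar_trace`, `trace_neg`), so the comparison map is well defined on
`Γ(G)`.

Every `ℚ/ℤ`-valued quadratic function is a trace (`exists_cocycle_of_quadratic`), which gives
injectivity. The function is pulled back to a free group `F` over `G`, written there as the diagonal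
of a bilinear form, and the form is corrected by an antisymmetrization until it vanishes on the
relations (`exists_bilinear_lift`). A set-theoretic section then yields the cocycle.

A cocycle with zero trace vanishes on cycles (`eq_zero_of_trace_eq_zero`), which gives surjectivity
by applying it to characters of the cokernel. A cycle involves finitely many elements, so it is
enough that the cocycle is a coboundary on finitely generated subgroups. This is done by hand over
`ℤ`, passes to direct products through an explicit cochain (`isCoboundaryOf_coprod`), and descends
along surjections because abelian extensions by the divisible group `ℚ/ℤ` split. -/

namespace EilenbergMacLane

/-! ### Abelian cocycles, their traces and their normalization -/

section Cocycles

variable {G P M : Type*} [AddCommGroup G] [AddCommGroup P] [AddCommGroup M]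

/-- Abelian `3`-cocycles `(h, c)` on `G` with values in `M`. -/
structure IsAbelianCocycle (h : G → G → G → M) (c : G → G → M) : Prop where
  pentagon : ∀ x y z w,
    h y z w - h (x + y) z w + h x (y + z) w - h x y (z + w) + h x y z = 0
  hexagon_left : ∀ x y z,
    c y z - c (x + y) z + c x z + h x y z - h x z y + h z x y = 0
  hexagon_right : ∀ x y z,
    c x z - c x (y + z) + c x y - h x y z + h y x z - h y z x = 0

/-- `(h, c)` is the coboundary of `k`. -/
structure IsCoboundaryOf (k : G → G → M) (h : G → G → G → M) (c : G → G → M) : Prop where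
  assoc : ∀ x y z, h x y z = k y z - k (x + y) z + k x (y + z) - k x y
  comm : ∀ x y, c x y = k y x - k x y

variable {h : G → G → G → M} {c : G → G → M}

namespace IsAbelianCocycle

/-- The hexagons expand `c (x + y) (x + y)` in both variables into the four values of `c` plus
associators; the associators left over form the pentagon at `(x, y, x, y)`. -/
lemma polar_trace (hc : IsAbelianCocycle h c) (x y : G) :
    QuadraticMap.polar (fun x => c x x) x y = c x y + c y x := by
  have e₁ := hc.hexagon_left x y (x + y)
  have e₂ := hc.hexagon_right x x y
  have e₃ := hc.hexagon_right y x y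
  have e₄ := hc.pentagon x y x y
  rw [add_comm y x] at e₄
  simp only [QuadraticMap.polar]
  linear_combination (norm := abel) -e₁ - e₂ - e₃ - e₄

/-- The symmetrization of `c` is biadditive although `c` is not: the associator terms of the left
hexagon at `(x, x', y)` and of the right hexagon at `(y, x, x')` are opposite. -/
lemma polar_trace_add_left (hc : IsAbelianCocycle h c) (x x' y : G) :
    QuadraticMap.polar (fun x => c x x) (x + x') y =
      QuadraticMap.polar (fun x => c x x) x y + QuadraticMap.polar (fun x => c x x) x' y := by
  simp only [hc.polar_trace]
  linear_combination (norm := abel) -hc.hexagon_left x x' y - hc.hexagon_right y x x'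

lemma polar_trace_add_right (hc : IsAbelianCocycle h c) (x y y' : G) :
    QuadraticMap.polar (fun x => c x x) x (y + y') =
      QuadraticMap.polar (fun x => c x x) x y + QuadraticMap.polar (fun x => c x x) x y' := by
  simpa only [QuadraticMap.polar_comm _ x] using hc.polar_trace_add_left y y' x

/-- On the diagonal `polar_trace` gives twice the trace. Comparing this with biadditivity at `x +
(-x) = 0` leaves the evenness of the trace. -/
lemma trace_neg (hc : IsAbelianCocycle h c) (x : G) : c (-x) (-x) = c x x := by
  have e₀ := hc.polar_trace_add_left 0 0 x
  have e₁ := hc.polar_trace_add_left x (-x) x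
  have e₂ := hc.polar_trace x (-x)
  have e₃ := hc.polar_trace x x
  have e₄ := hc.polar_trace (-x) x
  rw [add_neg_cancel] at e₁
  rw [add_zero] at e₀
  simp only [QuadraticMap.polar, add_neg_cancel, neg_add_cancel, zero_add] at *
  linear_combination (norm := abel) e₁ + e₃ + e₀ + e₀

/-- Subtracting a coboundary. -/
lemma sub_coboundary (hc : IsAbelianCocycle h c) (k : G → G → M) :
    IsAbelianCocycle (fun x y z => h x y z - (k y z - k (x + y) z + k x (y + z) - k x y))
      (fun x y => c x y - (k y x - k x y)) where
  pentagon x y z w := by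
    have e := hc.pentagon x y z w
    simp only [add_assoc] at e ⊢
    linear_combination (norm := abel) e
  hexagon_left x y z := by
    have e := hc.hexagon_left x y z
    simp only [add_comm z] at e ⊢
    linear_combination (norm := abel) e
  hexagon_right x y z := by
    have e := hc.hexagon_right x y z
    simp only [add_comm _ x] at e ⊢
    linear_combination (norm := abel) e

lemma comp_hom (hc : IsAbelianCocycle h c) (f : P →+ G) :
    IsAbelianCocycle (fun x y z => h (f x) (f y) (f z)) (fun x y => c (f x) (f y)) where
  pentagon x y z w := by simpa only [map_add] using hc.pentagon (f x) (f y) (f z) (f w)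
  hexagon_left x y z := by simpa only [map_add] using hc.hexagon_left (f x) (f y) (f z)
  hexagon_right x y z := by simpa only [map_add] using hc.hexagon_right (f x) (f y) (f z)

end IsAbelianCocycle

lemma IsCoboundaryOf.add {k k' : G → G → M}
    (hk' : IsCoboundaryOf k' (fun x y z => h x y z - (k y z - k (x + y) z + k x (y + z) - k x y))
      (fun x y => c x y - (k y x - k x y))) : IsCoboundaryOf (k + k') h c where
  assoc x y z := by
    simp only [Pi.add_apply]
    linear_combination (norm := abel) hk'.assoc x y z
  comm x y := by
    simp only [Pi.add_apply]
    linear_combination (norm := abel) hk'.comm x y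

/-- Abelian cocycles whose associator vanishes if one of the arguments is zero. -/
structure IsNormalizedCocycle (h : G → G → G → M) (c : G → G → M) : Prop extends
    IsAbelianCocycle h c where
  zero_left : ∀ y z, h 0 y z = 0
  zero_mid : ∀ x z, h x 0 z = 0
  zero_right : ∀ x y, h x y 0 = 0

namespace IsNormalizedCocycle

lemma comm_zero_left (hc : IsNormalizedCocycle h c) (x : G) : c 0 x = 0 := by
  have e := hc.hexagon_left 0 0 x
  simpa [hc.zero_left, hc.zero_mid, hc.zero_right] using e

lemma comp_hom (hc : IsNormalizedCocycle h c) (f : P →+ G) :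
    IsNormalizedCocycle (fun x y z => h (f x) (f y) (f z)) (fun x y => c (f x) (f y)) where
  toIsAbelianCocycle := hc.toIsAbelianCocycle.comp_hom f
  zero_left y z := by simp [hc.zero_left]
  zero_mid x z := by simp [hc.zero_mid]
  zero_right x y := by simp [hc.zero_right]

end IsNormalizedCocycle

/-- Every abelian cocycle becomes normalized after subtracting a coboundary. -/
lemma IsAbelianCocycle.exists_normalized (hc : IsAbelianCocycle h c) :
    ∃ k : G → G → M, IsNormalizedCocycle
      (fun x y z => h x y z - (k y z - k (x + y) z + k x (y + z) - k x y))
      (fun x y => c x y - (k y x - k x y)) := by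
  -- Pentagons with zero entries express every value of `h` having a zero argument through the two
  -- functions `h 0 0 _` and `h _ 0 0`, from which the correcting cochain is built.
  have e₀ : h 0 0 0 = 0 := by simpa using hc.pentagon 0 0 0 0
  have e₁ x z : h x 0 z = h 0 0 z + h x 0 0 := by
    have e := hc.pentagon x 0 0 z
    simp only [add_zero, zero_add] at e
    linear_combination (norm := abel) -e
  have e₂ z w : h 0 z w = h 0 0 (z + w) - h 0 0 z := by
    have e := hc.pentagon 0 0 z w
    simp only [add_zero, zero_add] at e
    linear_combination (norm := abel) e
  have e₃ x y : h x y 0 = h (x + y) 0 0 - h y 0 0 := by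
    have e := hc.pentagon x y 0 0
    simp only [add_zero] at e
    linear_combination (norm := abel) e
  refine ⟨fun x y => h 0 0 y - h x 0 0, ⟨hc.sub_coboundary _, fun y z => ?_, fun x z => ?_,
    fun x y => ?_⟩⟩ <;> simp only [add_zero, zero_add, e₀]
  · rw [e₂]; abel
  · rw [e₁]; abel
  · rw [e₃]; abel

/-! ### Triviality along a sum of two homomorphisms -/

section Product

variable {A B : Type*} [AddCommGroup A] [AddCommGroup B]

/-- A cocycle with zero trace which is trivial along two homomorphisms is trivial along
their sum. -/
lemma IsAbelianCocycle.isCoboundaryOf_coprod (hc : IsAbelianCocycle h c) (h₀ : ∀ x, c x x = 0)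
    (i : A →+ G) (j : B →+ G) {kA : A → A → M} {kB : B → B → M}
    (hA : IsCoboundaryOf kA (fun x y z => h (i x) (i y) (i z)) (fun x y => c (i x) (i y)))
    (hB : IsCoboundaryOf kB (fun x y z => h (j x) (j y) (j z)) (fun x y => c (j x) (j y))) :
    IsCoboundaryOf (fun u v : A × B => kA u.1 v.1 + kB u.2 v.2 - c (j u.2) (i v.1) -
        h (i u.1) (j u.2) (i v.1 + j v.2) + h (j u.2) (i v.1) (j v.2) -
        h (i v.1) (j u.2) (j v.2) + h (i u.1) (i v.1) (j u.2 + j v.2))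
      (fun u v w => h (i.coprod j u) (i.coprod j v) (i.coprod j w))
      (fun u v => c (i.coprod j u) (i.coprod j v)) where
  -- Besides `kA` and `kB`, the cochain records the path of rebracketings `(a + x) + (b + y) → a +
  -- (x + (b + y)) → a + ((x + b) + y) → a + ((b + x) + y) → a + (b + (x + y)) → (a + b) + (x + y)`:
  -- four associators and one braiding of `x` past `b`. Its coherence is a combination of pentagons
  -- and hexagons.
  assoc := by
    rintro ⟨a, x⟩ ⟨b, y⟩ ⟨d, z⟩
    have e := hA.assoc a b d
    have e' := hB.assoc x y z
    simp only [AddMonoidHom.coprod_apply, Prod.fst_add, Prod.snd_add, map_add] at e e' ⊢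
    generalize i a = a, i b = b, i d = d, j x = x, j y = y, j z = z at *
    have e₁ := hc.hexagon_left x y d
    have e₂ := hc.hexagon_right x b d
    have e₃ := hc.pentagon a b (x + y) (d + z)
    have e₄ := hc.pentagon x y d z
    have e₅ := hc.pentagon b x y (d + z)
    have e₆ := hc.pentagon x b y (d + z)
    have e₇ := hc.pentagon a x (b + y) (d + z)
    have e₈ := hc.pentagon b x d (y + z)
    have e₉ := hc.pentagon a b d (x + y + z)
    have f₁ := hc.pentagon d x y z
    have f₂ := hc.pentagon b d x (y + z)
    have f₃ := hc.pentagon x d y z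
    have f₄ := hc.pentagon x b d (y + z)
    linear_combination (norm := abel_nf)
      e + e' + e₁ - e₂ + e₃ - e₄ - e₅ + e₆ - e₇ + e₈ - e₉ - f₁ - f₂ + f₃ - f₄
  comm := by
    -- Only here is the zero trace used: it makes the braiding antisymmetric, so that moving `a`
    -- past `y` undoes moving `y` past `a`.
    have hs x y : c x y + c y x = 0 := by
      rw [← hc.polar_trace]
      simp [QuadraticMap.polar, h₀]
    rintro ⟨a, x⟩ ⟨b, y⟩
    have e := hA.comm a b
    have e' := hB.comm x y
    simp only [AddMonoidHom.coprod_apply] at e e' ⊢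
    generalize i a = a, i b = b, j x = x, j y = y at *
    have e₁ := hs a y
    have e₂ := hc.pentagon b y x a
    have e₃ := hc.hexagon_right a (b + y) x
    have e₄ := hc.hexagon_right a b (x + y)
    have e₅ := hc.hexagon_right x b y
    have e₆ := hc.hexagon_left a x (b + y)
    have e₇ := hc.hexagon_right a y x
    linear_combination (norm := abel_nf) e + e' + e₁ - e₂ + e₃ - e₄ - e₅ - e₆ - e₇

end Product

/-! ### Triviality over the integers -/

section Integers

lemma exists_antidifference (g : ℤ → M) : ∃ f : ℤ → M, f 0 = 0 ∧ ∀ m, f (m + 1) = f m + g m := by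
  refine ⟨fun m => ∑ i ∈ Finset.Ico 0 m, g i - ∑ i ∈ Finset.Ico m 0, g i, by simp, fun m => ?_⟩
  dsimp only
  rcases le_or_gt 0 m with hm | hm
  · have e : Finset.Ico 0 (m + 1) = insert m (Finset.Ico 0 m) := by ext; simp; lia
    rw [e, Finset.sum_insert (by simp), Finset.Ico_eq_empty (show ¬ m < 0 by lia),
      Finset.Ico_eq_empty (show ¬ m + 1 < 0 by lia)]
    simp [add_comm]
  · have e : Finset.Ico m 0 = insert m (Finset.Ico (m + 1) 0) := by ext; simp; lia
    rw [e, Finset.sum_insert (by simp), Finset.Ico_eq_empty (show ¬ 0 < m by lia),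
      Finset.Ico_eq_empty (show ¬ 0 < m + 1 by lia)]
    simp

/-- Normalized cocycles on `ℤ` with zero trace are trivial. -/
lemma IsNormalizedCocycle.exists_isCoboundaryOf_int {h : ℤ → ℤ → ℤ → M} {c : ℤ → ℤ → M}
    (hc : IsNormalizedCocycle h c) (h₀ : c 1 1 = 0) : ∃ k, IsCoboundaryOf k h c := by
  -- The cochain `(m, z) ↦ f z m` is chosen to have coboundary `h 1 y z` at `(1, y, z)`; the terms
  -- `f _ 1` drop out because `h 1 0 z = 0`.
  choose f hf₀ hf₁ using fun z => exists_antidifference (fun m => -h 1 m z)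
  have hf₁' z m : f z (1 + m) = f z m - h 1 m z := by rw [add_comm, hf₁, sub_eq_add_neg]
  have hf₂ z : f z 1 = 0 := by simpa [hf₀, hc.zero_mid] using hf₁ z 0
  have hc' := hc.toIsAbelianCocycle.sub_coboundary (fun m z => f z m)
  refine ⟨_, IsCoboundaryOf.add (k := fun m z => f z m) (k' := 0) ?_⟩
  have t₀ : c 1 1 - (f 1 1 - f 1 1) = 0 := by simp [h₀]
  have t₁ y z : h 1 y z - (f z y - f z (1 + y) + f (y + z) 1 - f y 1) = 0 := by
    rw [hf₂, hf₂, hf₁']; abel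
  generalize hH : (fun x y z => h x y z - (f z y - f z (x + y) + f (y + z) x - f y x)) = H at *
  generalize hC : (fun x y => c x y - (f x y - f y x)) = C at *
  replace t₀ : C 1 1 = 0 := by rw [← hC]; exact t₀
  replace t₁ y z : H 1 y z = 0 := by rw [← hH]; exact t₁ y z
  -- With `H 1 _ _ = 0`, the pentagon starting with `1` says that `H` does not depend on its first
  -- argument, hence vanishes. The hexagons then make `C` biadditive, so it is determined by `C 1 1
  -- = 0`.
  have t₂ x y z : H (x + 1) y z = H x y z := by
    have e := hc'.pentagon 1 x y z
    simp only [t₁] at e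
    rw [add_comm x]
    linear_combination (norm := abel) -e
  have t₃ x y z : H x y z = H 0 y z := by
    induction x with
    | zero => rfl
    | succ i ih => rw [t₂, ih]
    | pred i ih => rw [← ih, ← t₂, sub_add_cancel]
  have t₄ x y z : H x y z = 0 := by rw [t₃, ← t₃ 1, t₁]
  have hl x y z : C (x + y) z = C x z + C y z := by
    have e := hc'.hexagon_left x y z
    simp only [t₄] at e
    linear_combination (norm := abel) -e
  have hr x y z : C x (y + z) = C x y + C x z := by
    have e := hc'.hexagon_right x y z
    simp only [t₄] at e
    linear_combination (norm := abel) -e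
  have h₁ x : C x 1 = 0 := by
    have := AddMonoidHom.ext_int (f := AddMonoidHom.mk' (C · 1) fun x y => hl x y 1) (g := 0) t₀
    exact DFunLike.congr_fun this x
  have h₂ x y : C x y = 0 := by
    have := AddMonoidHom.ext_int (f := AddMonoidHom.mk' (C x) fun y z => hr x y z) (g := 0) (h₁ x)
    exact DFunLike.congr_fun this y
  exact ⟨by simp [t₄], by simp [h₂]⟩

end Integers

end Cocycles

/-! ### Descent along surjections, and finitely generated subgroups -/

section Descent

/-- The set `M × K`, with the addition twisted by a `2`-cocycle `k` on `K` with values in `M`. -/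
structure TwistedSum {K M : Type*} (k : K → K → M) where
  /-- The component in `M`. -/
  fst : M
  /-- The component in `K`. -/
  snd : K

variable {K : Type*} [AddCommGroup K]

/-- The extension of `K` by `M` given by a symmetric `2`-cocycle. -/
abbrev TwistedSum.addCommGroup {M : Type*} [AddCommGroup M] {k : K → K → M}
    (symm : ∀ x y, k x y = k y x) (zero : ∀ x, k 0 x = 0)
    (cocycle : ∀ x y z, k y z - k (x + y) z + k x (y + z) - k x y = 0) :
    AddCommGroup (TwistedSum k) :=
  letI : Add (TwistedSum k) := ⟨fun a b => ⟨a.1 + b.1 + k a.2 b.2, a.2 + b.2⟩⟩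
  letI : Zero (TwistedSum k) := ⟨⟨0, 0⟩⟩
  letI : Neg (TwistedSum k) := ⟨fun a => ⟨-a.1 - k (-a.2) a.2, -a.2⟩⟩
  { AddGroup.ofLeftAxioms
      (by
        rintro ⟨m, x⟩ ⟨n, y⟩ ⟨p, z⟩
        refine congr_arg₂ TwistedSum.mk ?_ (add_assoc x y z)
        change m + n + k x y + p + k (x + y) z = m + (n + p + k y z) + k x (y + z)
        linear_combination (norm := abel) -cocycle x y z)
      (by
        rintro ⟨m, x⟩
        refine congr_arg₂ TwistedSum.mk ?_ (zero_add x)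
        change 0 + m + k 0 x = m
        rw [zero, zero_add, add_zero])
      (by
        rintro ⟨m, x⟩
        refine congr_arg₂ TwistedSum.mk ?_ (neg_add_cancel x)
        change -m - k (-x) x + m + k (-x) x = 0
        abel) with
    add_comm := by
      rintro ⟨m, x⟩ ⟨n, y⟩
      refine congr_arg₂ TwistedSum.mk ?_ (add_comm x y)
      change m + n + k x y = n + m + k y x
      rw [symm x y, add_comm m] }

/-- Characters extend along injective homomorphisms. -/
lemma exists_extension {A B : Type*} [AddCommGroup A] [AddCommGroup B] (i : A →+ B)
    (hi : Function.Injective i) (χ : A →+ AddCircle (1 : ℚ)) :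
    ∃ ψ : B →+ AddCircle (1 : ℚ), ∀ a, ψ (i a) = χ a := by
  obtain ⟨ψ, h⟩ := CharacterModule.dual_surjective_of_injective i.toIntLinearMap hi χ
  exact ⟨ψ, DFunLike.congr_fun h⟩

/-- Abelian extensions by `ℚ/ℤ` split. -/
lemma exists_eq_coboundary {k : K → K → AddCircle (1 : ℚ)}
    (symm : ∀ x y, k x y = k y x) (zero : ∀ x, k 0 x = 0)
    (cocycle : ∀ x y z, k y z - k (x + y) z + k x (y + z) - k x y = 0) :
    ∃ l : K → AddCircle (1 : ℚ), ∀ x y, k x y = l x + l y - l (x + y) := by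
  let := TwistedSum.addCommGroup symm zero cocycle
  have hadd (m n x y) : (⟨m, x⟩ + ⟨n, y⟩ : TwistedSum k) = ⟨m + n + k x y, x + y⟩ := rfl
  -- Extending the identity of `ℚ/ℤ` to the twisted sum gives a retraction `ψ`; its values on the
  -- section `x ↦ (0, x)` are the required `l`.
  obtain ⟨ψ, hψ⟩ := exists_extension (B := TwistedSum k)
    (AddMonoidHom.mk' (fun m => ⟨m, 0⟩) fun m n => by rw [hadd, zero, add_zero, add_zero])
    (fun m n e => congr_arg TwistedSum.fst e) (AddMonoidHom.id _)
  refine ⟨fun x => ψ ⟨0, x⟩, fun x y => ?_⟩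
  have e₁ := map_add ψ ⟨0, x⟩ ⟨0, y⟩
  have e₂ := map_add ψ ⟨k x y, 0⟩ ⟨0, x + y⟩
  have e₃ := hψ (k x y)
  simp only [hadd, zero, zero_add, add_zero] at e₁ e₂
  simp only [AddMonoidHom.mk'_apply, AddMonoidHom.id_apply] at e₃
  rw [← e₁, e₂, e₃, add_sub_cancel_right]

variable {G P : Type*} [AddCommGroup G] [AddCommGroup P]
  {h : G → G → G → AddCircle (1 : ℚ)} {c : G → G → AddCircle (1 : ℚ)}

/-- A normalized cocycle with values in `ℚ/ℤ` is trivial if it is trivial along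
a surjective homomorphism. -/
lemma IsNormalizedCocycle.exists_isCoboundaryOf_of_surjective (hc : IsNormalizedCocycle h c)
    (f : P →+ G) (hf : Function.Surjective f) {k : P → P → AddCircle (1 : ℚ)}
    (hk : IsCoboundaryOf k (fun x y z => h (f x) (f y) (f z)) (fun x y => c (f x) (f y))) :
    ∃ k, IsCoboundaryOf k h c := by
  -- We may assume that `k` is normalized.
  wlog hk₀ : k 0 0 = 0 generalizing k
  · refine this (k := fun x y => k x y - k 0 0) ⟨fun x y z => ?_, fun x y => ?_⟩ (sub_self _)
    · rw [hk.assoc]; abel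
    · rw [hk.comm]; abel
  have hkl x : k 0 x = 0 := by
    have e := hk.assoc 0 0 x
    simp only [map_zero, hc.zero_left, zero_add, hk₀] at e
    linear_combination (norm := abel) -e
  have hkr x : k x 0 = 0 := by
    have e := hk.assoc x 0 0
    simp only [map_zero, hc.zero_right, add_zero, hk₀] at e
    linear_combination (norm := abel) e
  -- Normalization kills `h` and `c` when the first argument comes from the kernel of `f`; so `k` is
  -- symmetric against the kernel, and on the kernel it is a symmetric `2`-cocycle.
  have hsymm (r : f.ker) (x : P) : k r x = k x r := by
    have e := hk.comm r x
    simp only [f.mem_ker.1 r.2, hc.comm_zero_left] at e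
    linear_combination (norm := abel) e
  -- The restriction of `k` to the kernel splits.
  obtain ⟨l₀, hl₀⟩ := exists_eq_coboundary (K := f.ker) (k := fun r r' => k r r')
    (fun r r' => hsymm r r') (fun r => hkl r) (fun r r' r'' => by
      have e := hk.assoc r r' r''
      simp only [f.mem_ker.1 r.2, hc.zero_left] at e
      exact e.symm)
  let s := Function.surjInv hf
  have hs x : f (s x) = x := Function.surjInv_eq hf x
  let ρ (x : P) : f.ker := ⟨x - s (f x), by rw [AddMonoidHom.mem_ker, map_sub, hs, sub_self]⟩
  -- Each `x` is split as `ρ x + s (f x)` with `ρ x` in the kernel. This extension of the splitting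
  -- to `P` is forced, up to its values on the section, by requiring `k r x = l₀ r + l x - l (r +
  -- x)`.
  let l (x : P) := l₀ (ρ x) - k (ρ x) (s (f x))
  have hl (r : f.ker) (x : P) : k r x = l₀ r + l x - l (r + x) := by
    have hfr : f (r + x) = f x := by rw [map_add, f.mem_ker.1 r.2, zero_add]
    have hρ : ρ (r + x) = r + ρ x := Subtype.ext (by simp only [ρ, hfr, AddSubgroup.coe_add]; abel)
    have hx : (ρ x : P) + s (f x) = x := sub_add_cancel _ _
    have e₁ := hk.assoc r (ρ x) (s (f x))
    have e₂ := hl₀ r (ρ x)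
    simp only [f.mem_ker.1 r.2, hc.zero_left, hx] at e₁
    simp only [l, hfr, hρ, AddSubgroup.coe_add]
    linear_combination (norm := abel) -e₁ + e₂
  -- The section need not send `0` to `0`, so `l` extends `l₀` only up to the constant `l 0`; the
  -- constant in `k'` compensates for this and does not change the coboundary.
  have hl' (r : f.ker) : l r = l₀ r + l 0 := by
    have e := hl r 0
    rw [hkr, add_zero] at e
    linear_combination (norm := abel) e
  -- The modified `k` only depends on the images in `G`.
  let k' (x y : P) := k x y - (l x + l y - l (x + y) - l 0)
  have hk' : IsCoboundaryOf k' (fun x y z => h (f x) (f y) (f z)) (fun x y => c (f x) (f y)) := by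
    refine ⟨fun x y z => ?_, fun x y => ?_⟩
    · simp only [k', hk.assoc, ← add_assoc]
      abel
    · simp only [k', hk.comm, add_comm y x]
      abel
  have hkl' (r : f.ker) (x : P) : k' r x = 0 := by
    simp only [k', hl', hl r x]
    abel
  have hkr' (r : f.ker) (x : P) : k' x r = 0 := by
    simp only [k', ← hsymm, hl', hl r x, add_comm x]
    abel
  have hl'' (r : f.ker) (x y : P) : k' (r + x) y = k' x y := by
    have e := hk'.assoc r x y
    simp only [f.mem_ker.1 r.2, hc.zero_left, hkl'] at e
    linear_combination (norm := abel) e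
  have hr'' (r : f.ker) (x y : P) : k' x (y + r) = k' x y := by
    have e := hk'.assoc x y r
    simp only [f.mem_ker.1 r.2, hc.zero_right, hkr'] at e
    linear_combination (norm := abel) -e
  have hρ x : (ρ x : P) + s (f x) = x := sub_add_cancel _ _
  have hK x y : k' (s (f x)) (s (f y)) = k' x y := by
    rw [← hl'' (ρ x), ← hr'' (ρ y), add_comm _ (ρ y : P), hρ, hρ]
  refine ⟨fun x y => k' (s x) (s y), fun x y z => ?_, fun x y => ?_⟩
  · obtain ⟨x, rfl⟩ := hf x
    obtain ⟨y, rfl⟩ := hf y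
    obtain ⟨z, rfl⟩ := hf z
    simp only [← map_add, hK]
    exact hk'.assoc x y z
  · obtain ⟨x, rfl⟩ := hf x
    obtain ⟨y, rfl⟩ := hf y
    simp only [hK]
    exact hk'.comm x y

/-- A cocycle with values in `ℚ/ℤ` and zero trace is trivial on finitely generated subgroups. -/
lemma IsNormalizedCocycle.exists_isCoboundaryOf_fg (hc : IsNormalizedCocycle h c)
    (h₀ : ∀ x, c x x = 0) (N : Submodule ℤ G) (hN : N.FG) :
    ∃ k : N → N → AddCircle (1 : ℚ),
      IsCoboundaryOf k (fun x y z => h x y z) (fun x y => c x y) := by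
  induction N, hN using Submodule.fg_induction with
  | singleton x =>
    have hx := hc.comp_hom (Submodule.subtype (Submodule.span ℤ {x})).toAddMonoidHom
    -- A cyclic group is a quotient of `ℤ`, where only the trace at the generator matters.
    let f := (LinearMap.toSpanSingleton ℤ _
      (⟨x, Submodule.mem_span_singleton_self x⟩ : Submodule.span ℤ {x})).toAddMonoidHom
    obtain ⟨k, hk⟩ := (hx.comp_hom f).exists_isCoboundaryOf_int (h₀ _)
    refine hx.exists_isCoboundaryOf_of_surjective f ?_ hk
    rintro ⟨y, hy⟩
    obtain ⟨n, rfl⟩ := Submodule.mem_span_singleton.1 hy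
    exact ⟨n, rfl⟩
  | sup N₁ N₂ _ _ ih₁ ih₂ =>
    obtain ⟨k₁, hk₁⟩ := ih₁
    obtain ⟨k₂, hk₂⟩ := ih₂
    have hN := hc.comp_hom (Submodule.subtype (N₁ ⊔ N₂)).toAddMonoidHom
    -- The sum `N₁ ⊔ N₂` is a quotient of `N₁ × N₂`, where the explicit cochain for products
    -- applies.
    refine hN.exists_isCoboundaryOf_of_surjective
      ((Submodule.inclusion (le_sup_left (a := N₁) (b := N₂))).toAddMonoidHom.coprod
      (Submodule.inclusion (le_sup_right (a := N₁) (b := N₂))).toAddMonoidHom) ?_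
      (hN.toIsAbelianCocycle.isCoboundaryOf_coprod (fun x => h₀ x) _ _ hk₁ hk₂)
    rintro ⟨y, hy⟩
    obtain ⟨a, ha, b, hb, rfl⟩ := Submodule.mem_sup.1 hy
    exact ⟨(⟨a, ha⟩, ⟨b, hb⟩), rfl⟩

end Descent

/-! ### Quadratic functions as traces of cocycles -/

section Traces

open TensorProduct

/-- Alternating bilinear maps on free modules are antisymmetrizations. -/
lemma exists_eq_sub_flip {R M N : Type*} [CommRing R] [AddCommGroup M] [Module R M]
    [Module.Free R M] [AddCommGroup N] [Module R N] (A : M →ₗ[R] M →ₗ[R] N)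
    (hA : ∀ x, A x x = 0) : ∃ B : M →ₗ[R] M →ₗ[R] N, ∀ x y, A x y = B x y - B y x := by
  have hA' x y : A x y = -A y x := by
    have e := hA (x + y)
    simp only [map_add, LinearMap.add_apply, hA] at e
    rw [eq_neg_iff_add_eq_zero, add_comm]
    simpa using e
  obtain ⟨ι, b⟩ := Module.Free.exists_basis (R := R) (M := M)
  let : LinearOrder ι := IsWellOrder.linearOrder WellOrderingRel
  -- The strictly upper triangular part of `A` with respect to an ordered basis.
  let B : M →ₗ[R] M →ₗ[R] N := b.constr R fun i => b.constr R fun j =>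
    if i < j then A (b i) (b j) else 0
  refine ⟨B, fun x y => LinearMap.congr_fun₂ (?_ : A = B - B.flip) x y⟩
  refine b.ext fun i => b.ext fun j => ?_
  simp only [B, LinearMap.sub_apply, LinearMap.flip_apply, Module.Basis.constr_basis]
  rcases lt_trichotomy i j with h | rfl | h
  · simp [h, h.not_gt]
  · simp [hA]
  · simp [h, h.not_gt, ← hA']

/-- Alternating bilinear maps on torsion-free abelian groups vanish on symmetric tensors. -/
lemma lift_eq_zero_of_comm_eq {R N : Type*} [AddCommGroup R] [Module.IsTorsionFree ℤ R]
    [AddCommGroup N] (A : R →ₗ[ℤ] R →ₗ[ℤ] N) (hA : ∀ x, A x x = 0) (t : R ⊗[ℤ] R)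
    (ht : TensorProduct.comm ℤ R R t = t) : TensorProduct.lift A t = 0 := by
  -- The tensor lives over a finitely generated, hence free, subgroup `S`, and by flatness it is
  -- already symmetric there. On `S` the form is an antisymmetrization, which kills symmetric
  -- tensors.
  obtain ⟨R₁, R₂, h₁, h₂, h⟩ := TensorProduct.exists_finite_submodule_of_setFinite {t} (by simp)
  let S := R₁ ⊔ R₂
  obtain ⟨t', rfl⟩ := TensorProduct.range_mapIncl_mono (le_sup_left : R₁ ≤ S)
    (le_sup_right : R₂ ≤ S)
    (h (Set.mem_singleton t))
  have ht' : TensorProduct.comm ℤ S S t' = t' := by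
    refine TensorProduct.map_injective_of_flat_flat S.subtype S.subtype S.subtype_injective
      S.subtype_injective ?_
    refine Eq.trans ?_ ht
    rw [TensorProduct.mapIncl, TensorProduct.map_comm]
  obtain ⟨B, hB⟩ := exists_eq_sub_flip (A.compl₁₂ S.subtype S.subtype) (fun x => hA x)
  have e : TensorProduct.lift A ∘ₗ TensorProduct.mapIncl S S =
      TensorProduct.lift B - TensorProduct.lift B ∘ₗ (TensorProduct.comm ℤ S S).toLinearMap :=
    TensorProduct.ext' fun x y => by simpa using hB x y
  have e' := LinearMap.congr_fun e t'
  simpa [ht'] using e'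

/-- Homomorphisms to `ℚ/ℤ` extend along `T` if they vanish on its kernel. -/
lemma exists_factorization {X Y : Type*} [AddCommGroup X] [AddCommGroup Y] (T : X →+ Y)
    (χ : X →+ AddCircle (1 : ℚ)) (hT : ∀ x, T x = 0 → χ x = 0) :
    ∃ ψ : Y →+ AddCircle (1 : ℚ), ∀ x, ψ (T x) = χ x := by
  obtain ⟨ψ, hψ⟩ := exists_extension (QuotientAddGroup.kerLift T)
    (QuotientAddGroup.kerLift_injective T) (QuotientAddGroup.lift T.ker χ hT)
  exact ⟨ψ, fun x => hψ x⟩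

variable {G F : Type*} [AddCommGroup G] [AddCommGroup F]

/-- A `ℚ/ℤ`-valued quadratic function on a quotient of a free abelian group lifts to a bilinear
map which vanishes on the kernel. -/
lemma exists_bilinear_lift [Module.Free ℤ F] (q : G → AddCircle (1 : ℚ))
    (hneg : ∀ a, q (-a) = q a)
    (hadd : ∀ a a' b, QuadraticMap.polar q (a + a') b =
      QuadraticMap.polar q a b + QuadraticMap.polar q a' b) (π : F →ₗ[ℤ] G) :
    ∃ e : F →ₗ[ℤ] F →ₗ[ℤ] AddCircle (1 : ℚ), (∀ u, e u u = q (π u)) ∧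
      (∀ r s, π r = 0 → π s = 0 → e r s = 0) ∧ (∀ r u, π r = 0 → e r u = -e u r) := by
  have hsmul' (n : ℤ) (a b : G) :
      QuadraticMap.polar q (n • a) b = n • QuadraticMap.polar q a b :=
    map_zsmul (AddMonoidHom.mk' (QuadraticMap.polar q · b) (hadd · · b)) n a
  have h₀ : q 0 = 0 := by
    have e := hadd 0 0 0
    simpa [QuadraticMap.polar] using e
  -- This is where evenness of `q` enters. It gives `q (n • a) = n² • q a`, so that `q` is a
  -- quadratic map over `ℤ` and its pullback to the free group `F` is the diagonal of a bilinear
  -- form.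
  have h₂ a : QuadraticMap.polar q a a = q a + q a := by
    have e := hsmul' (-1) a a
    simp only [QuadraticMap.polar, neg_smul, one_smul, neg_add_cancel, h₀, hneg] at e ⊢
    linear_combination (norm := abel) e
  have hsmul (n : ℤ) (a : G) : q (n • a) = (n * n) • q a := by
    have step (m : ℤ) : q ((m + 1) • a) = q (m • a) + q a + m • (q a + q a) := by
      rw [← h₂, ← hsmul', add_smul, one_smul, QuadraticMap.polar]
      abel
    induction n with
    | zero => simp [h₀]
    | succ i ih => rw [step, ih]; module
    | pred i ih =>
      have e := step (-i - 1)
      rw [sub_add_cancel, ih] at e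
      rw [← sub_eq_zero] at e ⊢
      rw [← neg_eq_zero, ← e]
      module
  let Q : QuadraticMap ℤ G (AddCircle (1 : ℚ)) := QuadraticMap.ofPolar q hsmul hadd hsmul'
  obtain ⟨e₀, he₀⟩ := LinearMap.BilinMap.toQuadraticMap_surjective (Q.comp π)
  have hq u : e₀ u u = q (π u) := DFunLike.congr_fun he₀ u
  have hr u v (hu : π u = 0) : e₀ u v + e₀ v u = 0 := by
    have e := hq (u + v)
    simp only [map_add, LinearMap.add_apply, hq, hu, h₀, zero_add] at e
    linear_combination (norm := abel) e
  let R := LinearMap.ker π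
  let A := e₀.compl₁₂ R.subtype R.subtype
  -- On `R = ker π` the form `e₀` is alternating, and it has to become the antisymmetrization of a
  -- form `B` on all of `F`. This asks for a character of `F ⊗ F` that restricts to `e₀` along `T`;
  -- it exists because `ker T` consists of symmetric tensors, on which `e₀` vanishes. Subtracting
  -- the antisymmetrization keeps the diagonal.
  let T := TensorProduct.mapIncl R R ∘ₗ
    (LinearMap.id - (TensorProduct.comm ℤ R R).toLinearMap)
  obtain ⟨ψ, hψ⟩ := exists_factorization T.toAddMonoidHom
    (TensorProduct.lift A).toAddMonoidHom (fun t ht => by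
      refine lift_eq_zero_of_comm_eq A (fun r => ?_) t ?_
      · exact (hq r).trans (by rw [LinearMap.mem_ker.1 r.2, h₀])
      · have := TensorProduct.map_injective_of_flat_flat R.subtype R.subtype R.subtype_injective
          R.subtype_injective (ht.trans (map_zero _).symm)
        exact (sub_eq_zero.1 this).symm)
  let B : F →ₗ[ℤ] F →ₗ[ℤ] AddCircle (1 : ℚ) :=
    (TensorProduct.mk ℤ F F).compr₂ ψ.toIntLinearMap
  have hB r s (hr : π r = 0) (hs : π s = 0) : B r s - B s r = e₀ r s := by
    have e : ψ (r ⊗ₜ s) - ψ (s ⊗ₜ r) = e₀ r s := by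
      simpa [T, A] using hψ ((⟨r, hr⟩ : R) ⊗ₜ (⟨s, hs⟩ : R))
    exact e
  refine ⟨e₀ - B + B.flip, fun u => ?_, fun r s hr hs => ?_, fun r u h => ?_⟩
  · simp [hq]
  · simp only [LinearMap.add_apply, LinearMap.sub_apply, LinearMap.flip_apply, ← hB r s hr hs]
    abel
  · simp only [LinearMap.add_apply, LinearMap.sub_apply, LinearMap.flip_apply]
    linear_combination (norm := abel) hr r u h

/-- Every `ℚ/ℤ`-valued quadratic function is the trace of an abelian cocycle. -/
lemma exists_cocycle_of_quadratic (q : G → AddCircle (1 : ℚ)) (hneg : ∀ a, q (-a) = q a)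
    (hadd : ∀ a a' b, QuadraticMap.polar q (a + a') b =
      QuadraticMap.polar q a b + QuadraticMap.polar q a' b) :
    ∃ h c, IsAbelianCocycle h c ∧ ∀ x, c x x = q x := by
  obtain ⟨e, hq, hR, hF⟩ := exists_bilinear_lift q hneg hadd
    (Finsupp.linearCombination ℤ (id : G → G))
  let s (x : G) : G →₀ ℤ := Finsupp.single x 1
  let ρ (x y : G) := s x + s y - s (x + y)
  have hs x : Finsupp.linearCombination ℤ (id : G → G) (s x) = x := by simp [s]
  have hρ x y : Finsupp.linearCombination ℤ (id : G → G) (ρ x y) = 0 := by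
    simp only [ρ, map_sub, map_add, hs, sub_self]
  -- Since `ρ` is a symmetric `2`-cocycle with values in the relations, the pentagon reduces to `e
  -- (ρ x y) (ρ z w) = 0` and the left hexagon to the antisymmetry of `e` against relations. The
  -- right hexagon holds by construction.
  refine ⟨fun x y z => e (s x) (ρ y z), fun x y => e (s x) (s y),
    ⟨fun x y z w => ?_, fun x y z => ?_, fun x y z => ?_⟩, fun x => by simp only [hq, hs]⟩
  · have e₁ := hR _ _ (hρ x y) (hρ z w)
    simp only [ρ, map_sub, map_add, LinearMap.add_apply, LinearMap.sub_apply, add_assoc] at e₁ ⊢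
    linear_combination (norm := abel) e₁
  · have e₁ := hF _ (s z) (hρ x y)
    simp only [ρ, map_sub, map_add, LinearMap.add_apply, LinearMap.sub_apply, add_comm z] at e₁ ⊢
    linear_combination (norm := abel) e₁
  · simp only [ρ, map_sub, map_add, add_comm _ x]
    abel

end Traces

/-! ### Low-degree words: cochains on them are abelian cocycles -/

section LowDegrees

variable {G : Type u} [AddCommGroup G] {M : Type*} [AddCommGroup M]

/-- These are the basis words of `chains G 3`, because of the degree shift; longer letters or
further letters would exceed the degree. -/
lemma wordsOfDegree_four {w : List (List G)} (hw : w ∈ wordsOfDegree G 4) :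
    (∃ x y z, w = [[x, y, z]]) ∨ ∃ x y, w = [[x], [y]] := by
  obtain ⟨h, h'⟩ := hw
  rcases w with _ | ⟨_ | ⟨x, _ | ⟨y, _ | ⟨z, _ | ⟨t, a⟩⟩⟩⟩,
    _ | ⟨_ | ⟨x', _ | ⟨y', b⟩⟩, _ | ⟨_ | ⟨x'', b'⟩, w⟩⟩⟩ <;>
    simp [wordDegree] at h h' ⊢ <;> lia

lemma wordsOfDegree_five {w : List (List G)} (hw : w ∈ wordsOfDegree G 5) :
    (∃ x y z t, w = [[x, y, z, t]]) ∨ (∃ x y z, w = [[x, y], [z]]) ∨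
      ∃ x y z, w = [[x], [y, z]] := by
  obtain ⟨h, h'⟩ := hw
  rcases w with _ | ⟨_ | ⟨x, _ | ⟨y, _ | ⟨z, _ | ⟨t, _ | ⟨s, a⟩⟩⟩⟩⟩,
    _ | ⟨_ | ⟨x', _ | ⟨y', _ | ⟨z', b⟩⟩⟩, _ | ⟨_ | ⟨x'', b'⟩, w⟩⟩⟩ <;>
    simp [wordDegree] at h h' ⊢ <;> lia

lemma totalD_three (x y z : G) : totalD (cell [[x, y, z]]) =
    cell [[y, z]] - cell [[x + y, z]] + cell [[x, y + z]] - cell [[x, y]] := by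
  simp [totalD, wordD, barD, headFace, tailFaces, mergeCell, push_cell]
  abel

lemma totalD_one_one (x y : G) : totalD (cell [[x], [y]]) = cell [[y, x]] - cell [[x, y]] := by
  simp [totalD, wordD, barD, headFace, tailFaces, mergeCell, push_cell, mulWord, shuffleCell]
  abel

lemma totalD_four (x y z t : G) : totalD (cell [[x, y, z, t]]) =
    cell [[y, z, t]] - cell [[x + y, z, t]] + cell [[x, y + z, t]] - cell [[x, y, z + t]] +
      cell [[x, y, z]] := by
  simp [totalD, wordD, barD, headFace, tailFaces, mergeCell, push_cell]
  abel

lemma totalD_two_one (x y z : G) : totalD (cell [[x, y], [z]]) =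
    cell [[y], [z]] - cell [[x + y], [z]] + cell [[x], [z]] +
      cell [[x, y, z]] - cell [[x, z, y]] + cell [[z, x, y]] := by
  simp [totalD, wordD, barD, headFace, tailFaces, mergeCell, push_cell, mulWord, shuffleCell]
  abel

lemma totalD_one_two (x y z : G) : totalD (cell [[x], [y, z]]) =
    cell [[x], [z]] - cell [[x], [y + z]] + cell [[x], [y]] -
      cell [[x, y, z]] + cell [[y, x, z]] - cell [[y, z, x]] := by
  simp [totalD, wordD, barD, headFace, tailFaces, mergeCell, push_cell, mulWord, shuffleCell]
  abel

lemma eq_zero_of_mem_chains {G : Type u} (f : Words G →+ M) {n : ℕ}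
    (hf : ∀ w ∈ wordsOfDegree G (n + 1), f (cell w) = 0) {W : Words G} (hW : W ∈ chains G n) :
    f W = 0 := by
  have : Finsupp.supported ℤ ℤ (wordsOfDegree G (n + 1)) ≤ LinearMap.ker f.toIntLinearMap := by
    rw [Finsupp.supported_eq_span_single, Submodule.span_le]
    rintro _ ⟨w, hw, rfl⟩
    exact hf w hw
  exact this hW

/-- Cochains of degree three which vanish on boundaries are abelian cocycles. -/
lemma isAbelianCocycle_of_cochain (Φ : Words G →+ M)
    (hΦ : ∀ W ∈ chains G 4, Φ (totalD W) = 0) :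
    IsAbelianCocycle (fun x y z => Φ (cell [[x, y, z]])) (fun x y => Φ (cell [[x], [y]])) where
  pentagon x y z t := by
    simpa [totalD_four] using
      hΦ (cell [[x, y, z, t]]) (cell_mem (by simp [wordsOfDegree, wordDegree]))
  hexagon_left x y z := by
    simpa [totalD_two_one] using
      hΦ (cell [[x, y], [z]]) (cell_mem (by simp [wordsOfDegree, wordDegree]))
  hexagon_right x y z := by
    simpa [totalD_one_two] using
      hΦ (cell [[x], [y, z]]) (cell_mem (by simp [wordsOfDegree, wordDegree]))

/-- The cochain given by an abelian cocycle. -/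
noncomputable def cochainOfCocycle {G : Type u} (h : G → G → G → M) (c : G → G → M) :
    Words G →+ M :=
  (Finsupp.linearCombination ℤ fun w : List (List G) => match w with
    | [[x, y, z]] => h x y z
    | [[x], [y]] => c x y
    | _ => 0).toAddMonoidHom

@[simp] lemma cochainOfCocycle_three {G : Type u} (h : G → G → G → M) (c : G → G → M) (x y z : G) :
    cochainOfCocycle h c (cell [[x, y, z]]) = h x y z := by
  simp [cochainOfCocycle, cell]

@[simp] lemma cochainOfCocycle_one_one {G : Type u} (h : G → G → G → M) (c : G → G → M) (x y : G) :
    cochainOfCocycle h c (cell [[x], [y]]) = c x y := by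
  simp [cochainOfCocycle, cell]

lemma cochainOfCocycle_totalD {h : G → G → G → M} {c : G → G → M} (hc : IsAbelianCocycle h c)
    {W : Words G} (hW : W ∈ chains G 4) : cochainOfCocycle h c (totalD W) = 0 := by
  refine eq_zero_of_mem_chains ((cochainOfCocycle h c).comp totalD.toAddMonoidHom)
    (fun w hw => ?_) hW
  obtain ⟨x, y, z, t, rfl⟩ | ⟨x, y, z, rfl⟩ | ⟨x, y, z, rfl⟩ := wordsOfDegree_five hw
  · simpa [totalD_four] using hc.pentagon x y z t
  · simpa [totalD_two_one] using hc.hexagon_left x y z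
  · simpa [totalD_one_two] using hc.hexagon_right x y z

/-- Cocycles with values in `ℚ/ℤ` and zero trace vanish on cycles. -/
lemma eq_zero_of_trace_eq_zero (Φ : Words G →+ AddCircle (1 : ℚ))
    (hΦ : ∀ W ∈ chains G 4, Φ (totalD W) = 0) (h₀ : ∀ x, Φ (cell [[x], [x]]) = 0)
    {W : Words G} (hW : W ∈ chains G 3) (hD : totalD W = 0) : Φ W = 0 := by
  obtain ⟨k₀, hk₀⟩ := (isAbelianCocycle_of_cochain Φ hΦ).exists_normalized
  -- All entries of the words in `W` lie in this finitely generated subgroup, so it suffices to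
  -- trivialize the cocycle there. Normalizing does not change the trace.
  let N : Submodule ℤ G := Submodule.span ℤ {x | ∃ w ∈ W.support, ∃ a ∈ w, x ∈ a}
  have hN : N.FG := Submodule.fg_span (by
    refine (W.support.finite_toSet.biUnion fun w _ =>
      w.finite_toSet.biUnion fun a _ => a.finite_toSet).subset ?_
    rintro x ⟨w, hw, a, ha, hx⟩
    simp only [Set.mem_iUnion]
    exact ⟨w, hw, a, ha, hx⟩)
  have hmem w (hw : w ∈ W.support) a (ha : a ∈ w) x (hx : x ∈ a) : x ∈ N :=
    Submodule.subset_span ⟨w, hw, a, ha, hx⟩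
  obtain ⟨k₁, hk₁⟩ := hk₀.exists_isCoboundaryOf_fg (fun x => by simp [h₀]) N hN
  classical
  -- The extension by zero outside `N` is harmless: boundaries of words with entries in `N` again
  -- have entries in `N`.
  let k (x y : G) := k₀ x y + if hxy : x ∈ N ∧ y ∈ N then k₁ ⟨x, hxy.1⟩ ⟨y, hxy.2⟩ else 0
  let Ψ : Words G →+ AddCircle (1 : ℚ) :=
    (Finsupp.linearCombination ℤ fun w : List (List G) => match w with
      | [[x, y]] => k x y
      | _ => 0).toAddMonoidHom
  have hΨ x y : Ψ (cell [[x, y]]) = k x y := by simp [Ψ, cell]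
  have key w (hw : w ∈ W.support) : Φ (cell w) = Ψ (totalD (cell w)) := by
    have hm := hmem w hw
    obtain ⟨x, y, z, rfl⟩ | ⟨x, y, rfl⟩ := wordsOfDegree_four (hW hw)
    · have hx : x ∈ N := hm [x, y, z] (by simp) x (by simp)
      have hy : y ∈ N := hm [x, y, z] (by simp) y (by simp)
      have hz : z ∈ N := hm [x, y, z] (by simp) z (by simp)
      have e := hk₁.assoc ⟨x, hx⟩ ⟨y, hy⟩ ⟨z, hz⟩
      simp only [totalD_three, map_add, map_sub, hΨ, k, hx, hy, hz, N.add_mem, and_self, dite_true]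
      simp only [AddMemClass.mk_add_mk] at e
      linear_combination (norm := abel) e
    · have hx : x ∈ N := hm [x] (by simp) x (by simp)
      have hy : y ∈ N := hm [y] (by simp) y (by simp)
      have e := hk₁.comm ⟨x, hx⟩ ⟨y, hy⟩
      simp only [totalD_one_one, map_sub, hΨ, k, hx, hy, and_self, dite_true]
      linear_combination (norm := abel) e
  have hsum : W = ∑ w ∈ W.support, W w • cell w := by
    conv_lhs => rw [← W.sum_single]
    simp [Finsupp.sum, cell]
  calc Φ W = ∑ w ∈ W.support, W w • Φ (cell w) := by
        conv_lhs => rw [hsum]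
        simp only [map_sum, map_zsmul]
    _ = Ψ (totalD (∑ w ∈ W.support, W w • cell w)) := by
        simp only [map_sum, map_zsmul]
        exact Finset.sum_congr rfl fun w hw => by rw [key w hw]
    _ = 0 := by rw [← hsum, hD, map_zero]

end LowDegrees

section Homology

/-! ### Homology of complexes of abelian groups -/

variable (K : HomologicalComplex AddCommGrpCat.{u} (ComplexShape.down ℕ)) (n : ℕ)

lemma iCycles_injective : Function.Injective (K.iCycles n) :=
  (AddCommGrpCat.mono_iff_injective _).1 inferInstance

lemma homologyπ_surjective : Function.Surjective (K.homologyπ n) :=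
  (AddCommGrpCat.epi_iff_surjective _).1 inferInstance

lemma homologyπ_toCycles (w : K.X (n + 1)) :
    K.homologyπ n (K.toCycles (n + 1) n w) = 0 := by
  rw [← ConcreteCategory.comp_apply, K.toCycles_comp_homologyπ]
  rfl

lemma iCycles_toCycles (w : K.X (n + 1)) :
    K.iCycles n (K.toCycles (n + 1) n w) = K.d (n + 1) n w := by
  rw [← ConcreteCategory.comp_apply, K.toCycles_i]

lemma d_iCycles (z : K.cycles (n + 1)) : K.d (n + 1) n (K.iCycles (n + 1) z) = 0 := by
  rw [← ConcreteCategory.comp_apply, K.iCycles_d]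
  rfl

lemma exists_toCycles_eq (z : K.cycles n) (hz : K.homologyπ n z = 0) :
    ∃ w, K.toCycles (n + 1) n w = z :=
  (ShortComplex.ab_exact_iff _).1
    (ShortComplex.exact_of_g_is_cokernel
      (ShortComplex.mk _ _ (K.toCycles_comp_homologyπ (n + 1) n))
      (K.homologyIsCokernel (n + 1) n (by simp))) z hz

variable {K n} in
lemma homologyMap_homologyπ {L : HomologicalComplex AddCommGrpCat.{u} (ComplexShape.down ℕ)}
    (φ : K ⟶ L) (z : K.cycles n) (z' : L.cycles n)
    (hz : L.iCycles n z' = φ.f n (K.iCycles n z)) :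
    HomologicalComplex.homologyMap φ n (K.homologyπ n z) = L.homologyπ n z' := by
  have e : HomologicalComplex.cyclesMap φ n z = z' := by
    apply iCycles_injective
    rw [hz, ← ConcreteCategory.comp_apply, HomologicalComplex.cyclesMap_i,
      ConcreteCategory.comp_apply]
  rw [← e, ← ConcreteCategory.comp_apply, ← ConcreteCategory.comp_apply,
    HomologicalComplex.homologyπ_naturality]

/-- Characters of the homology extend to the chains, where they vanish on boundaries. -/
lemma exists_cochain (χ : K.homology n →+ AddCircle (1 : ℚ)) :
    ∃ φ : K.X n →+ AddCircle (1 : ℚ), (∀ w, φ (K.d (n + 1) n w) = 0) ∧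
      ∀ z, φ (K.iCycles n z) = χ (K.homologyπ n z) := by
  obtain ⟨φ, hφ⟩ := exists_extension (K.iCycles n).hom (iCycles_injective K n)
    (χ.comp (K.homologyπ n).hom)
  have hφ' z : φ (K.iCycles n z) = χ (K.homologyπ n z) := hφ z
  refine ⟨φ, fun w => ?_, hφ'⟩
  rw [← iCycles_toCycles, hφ', homologyπ_toCycles, map_zero]

/-- Characters separate the points of an abelian group. -/
lemma eq_of_forall_character {A : Type*} [AddCommGroup A] {a b : A}
    (hab : ∀ χ : A →+ AddCircle (1 : ℚ), χ a = χ b) : a = b := by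
  rw [← sub_eq_zero]
  refine CharacterModule.eq_zero_of_character_apply fun χ => ?_
  rw [map_sub, sub_eq_zero]
  exact hab χ

end Homology

/-! ### The comparison map and its bijectivity -/

section Comparison

variable (G : AddCommGrpCat.{u})

/-- The cycles `[x] | [x]`. -/
noncomputable def selfBraiding (G : Type u) [AddCommGroup G] : FreeAbelianGroup G →+ chains G 3 :=
  FreeAbelianGroup.lift fun x => ⟨cell [[x], [x]], cell_mem (by simp [wordsOfDegree, wordDegree])⟩

lemma selfBraiding_of {G : Type u} [AddCommGroup G] (x : G) :
    (selfBraiding G (FreeAbelianGroup.of x) : Words G) = cell [[x], [x]] := by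
  simp [selfBraiding]

/-- `selfBraiding` as a morphism to the chain group of `A(G,2)`. -/
noncomputable def selfBraidingHom :
    AddCommGrpCat.of (FreeAbelianGroup G) ⟶ (complexA2 G).X 3 :=
  AddCommGrpCat.ofHom (selfBraiding G)

lemma selfBraidingHom_d : selfBraidingHom G ≫ (complexA2 G).d 3 2 = 0 := by
  rw [complexA2_d]
  ext1
  refine FreeAbelianGroup.lift_ext _ _ fun x => Subtype.ext ?_
  change totalD (selfBraiding G (FreeAbelianGroup.of x) : Words G) = 0
  rw [selfBraiding_of, totalD_one_one, sub_self]

/-- The lift of `selfBraidingHom` to the cycles. -/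
noncomputable def selfBraidingCycles :
    AddCommGrpCat.of (FreeAbelianGroup G) ⟶ (complexA2 G).cycles 3 :=
  (complexA2 G).liftCycles (selfBraidingHom G) 2 (by simp) (selfBraidingHom_d G)

lemma iCycles_selfBraidingCycles (f : FreeAbelianGroup G) :
    (complexA2 G).iCycles 3 (selfBraidingCycles G f) = selfBraiding G f := by
  rw [← ConcreteCategory.comp_apply, selfBraidingCycles, HomologicalComplex.liftCycles_i]
  rfl

/-- The homology classes of the cycles `[x] | [x]`. -/
noncomputable def selfBraidingClass :
    AddCommGrpCat.of (FreeAbelianGroup G) ⟶ (complexA2 G).homology 3 :=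
  selfBraidingCycles G ≫ (complexA2 G).homologyπ 3

/-- Characters of `H₃` are given by cochains. -/
lemma exists_cochain_of_character (χ : (complexA2 G).homology 3 →+ AddCircle (1 : ℚ)) :
    ∃ Φ : Words G →+ AddCircle (1 : ℚ), (∀ W ∈ chains G 4, Φ (totalD W) = 0) ∧
      (∀ z (W : chains G 3), (complexA2 G).iCycles 3 z = W →
        χ ((complexA2 G).homologyπ 3 z) = Φ W) := by
  -- The character is extended twice, from cycles to chains and from chains to all words, so that it
  -- can be evaluated on single words.
  obtain ⟨φ, hφ, hχ⟩ := exists_cochain (complexA2 G) 3 χ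
  obtain ⟨Φ, hΦ⟩ := exists_extension (chains G 3).subtype.toAddMonoidHom
    (chains G 3).subtype_injective φ
  refine ⟨Φ, fun W hW => ?_, fun z W hz => ?_⟩
  · have e := hφ (⟨W, hW⟩ : chains G 4)
    rw [complexA2_d] at e
    exact (hΦ _).trans e
  · rw [← hχ, hz]
    exact (hΦ W).symm

/-- Characters turn the class of `[x] | [x]` into the trace of an abelian cocycle, and the
identities for traces lift back because characters separate points. -/
lemma isQuadratic_selfBraidingClass :
    IsQuadratic (fun x : G => selfBraidingClass G (FreeAbelianGroup.of x)) := by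
  have key (χ : (complexA2 G).homology 3 →+ AddCircle (1 : ℚ)) :
      ∃ h c, IsAbelianCocycle h c ∧
        ∀ x : G, χ (selfBraidingClass G (FreeAbelianGroup.of x)) = c x x := by
    obtain ⟨Φ, hΦ, hχ⟩ := exists_cochain_of_character G χ
    refine ⟨_, _, isAbelianCocycle_of_cochain Φ hΦ, fun x => ?_⟩
    rw [← selfBraiding_of]
    exact hχ _ _ (iCycles_selfBraidingCycles G _)
  refine ⟨fun a => ?_, fun a a' b => ?_, fun a b b' => ?_⟩ <;>
    refine eq_of_forall_character fun χ => ?_ <;> obtain ⟨h, c, hc, hχ⟩ := key χ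
  · simp only [hχ, hc.trace_neg]
  · simpa only [QuadraticMap.polar, map_sub, map_add, hχ] using hc.polar_trace_add_left a a' b
  · simpa only [QuadraticMap.polar, map_sub, map_add, hχ] using hc.polar_trace_add_right a b b'

/-- The homomorphism `Γ(G) → H₃(A(G,2))` which sends `γ x` to the class of `[x] | [x]`. -/
noncomputable def gammaToHomology : gammaFunctor.obj G ⟶ (homology2ab 3).obj G :=
  AddCommGrpCat.ofHom (gammaLift _ (isQuadratic_selfBraidingClass G))

lemma gammaToHomology_gamma (x : G) :
    gammaToHomology G (gamma x) = selfBraidingClass G (FreeAbelianGroup.of x) :=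
  gammaLift_gamma _ (isQuadratic_selfBraidingClass G) x

lemma gammaToHomology_mk (f : FreeAbelianGroup G) :
    gammaToHomology G (QuotientAddGroup.mk' (AddSubgroup.closure (gammaRelators G)) f) =
      selfBraidingClass G f := by
  have e : (gammaToHomology G).hom.comp (QuotientAddGroup.mk' _) = (selfBraidingClass G).hom :=
    FreeAbelianGroup.lift_ext _ _ (gammaToHomology_gamma G)
  exact DFunLike.congr_fun e f

/-- A character `χ` of `Γ(G)` composed with `γ` is the trace of a cocycle. The cochain of that
cocycle computes `χ` on combinations of the `[x] | [x]` and kills boundaries, so `χ` vanishes on the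
kernel. -/
lemma gammaToHomology_injective : Function.Injective (gammaToHomology G) := by
  refine (injective_iff_map_eq_zero (gammaToHomology G).hom).2 fun ξ hξ => ?_
  refine CharacterModule.eq_zero_of_character_apply fun (χ : Gamma G →+ AddCircle (1 : ℚ)) => ?_
  obtain ⟨f, rfl⟩ := QuotientAddGroup.mk'_surjective _ ξ
  have hγ := isQuadratic_gamma (G := G)
  obtain ⟨h, c, hc, hχ⟩ := exists_cocycle_of_quadratic (fun x : G => χ (gamma x))
    (fun a => by rw [hγ.map_neg])
    (fun a a' b => by
      simpa only [QuadraticMap.polar, map_sub, map_add] using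
        congr_arg χ (hγ.polar_add_left a a' b))
  obtain ⟨w, hw⟩ := exists_toCycles_eq (complexA2 G) 3 (selfBraidingCycles G f)
    ((gammaToHomology_mk G f).symm.trans hξ)
  have hw' := congr_arg ((complexA2 G).iCycles 3) hw
  rw [iCycles_toCycles, iCycles_selfBraidingCycles, complexA2_d] at hw'
  have e : (cochainOfCocycle h c).comp ((chains G 3).subtype.toAddMonoidHom.comp
      (selfBraiding G)) = AddMonoidHom.comp χ (QuotientAddGroup.mk' _) :=
    FreeAbelianGroup.lift_ext _ _ fun x => by
      refine (congr_arg (cochainOfCocycle h c) (selfBraiding_of x)).trans ?_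
      rw [cochainOfCocycle_one_one, hχ]
      rfl
  refine (DFunLike.congr_fun e f).symm.trans ?_
  refine (congr_arg (fun W : chains G 3 => cochainOfCocycle h c W.1) hw'.symm).trans ?_
  exact cochainOfCocycle_totalD hc (Subtype.property (p := (· ∈ chains G 4)) w)

/-- A character of the cokernel is represented by a cochain that is zero on every `[x] | [x]`, that
is, by a cocycle with zero trace. It vanishes on all cycles, so the cokernel has no nonzero
character. -/
lemma gammaToHomology_surjective : Function.Surjective (gammaToHomology G) := by
  let R := (gammaToHomology G).hom.range
  intro y
  suffices h : QuotientAddGroup.mk' R y = 0 from (QuotientAddGroup.eq_zero_iff y).1 h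
  refine CharacterModule.eq_zero_of_character_apply fun χ => ?_
  obtain ⟨Φ, hΦ, hχ⟩ := exists_cochain_of_character G
    (AddMonoidHom.comp χ (QuotientAddGroup.mk' R))
  obtain ⟨z, rfl⟩ := homologyπ_surjective (complexA2 G) 3 y
  refine (hχ z ((complexA2 G).iCycles 3 z) rfl).trans ?_
  refine eq_zero_of_trace_eq_zero Φ hΦ (fun x => ?_) (Subtype.property _) ?_
  · rw [← selfBraiding_of, ← hχ _ _ (iCycles_selfBraidingCycles G _)]
    refine (congr_arg χ ((QuotientAddGroup.eq_zero_iff _).2 ?_)).trans (map_zero χ)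
    exact ⟨gamma x, gammaToHomology_gamma G x⟩
  · have e := d_iCycles (complexA2 G) 2 z
    rw [complexA2_d] at e
    exact congr_arg Subtype.val e

lemma gammaToHomology_naturality {G H : AddCommGrpCat.{u}} (f : G ⟶ H) :
    gammaFunctor.map f ≫ gammaToHomology H = gammaToHomology G ≫ (homology2ab 3).map f := by
  ext1
  refine gamma_hom_ext fun x => ?_
  have e₁ := gammaToHomology_gamma H (f.hom x)
  have e₂ := gammaToHomology_gamma G x
  have e₃ := homologyMap_homologyπ (K := complexA2 G) (L := complexA2 H) (functorA2.map f)
    (selfBraidingCycles G (FreeAbelianGroup.of x))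
    (selfBraidingCycles H (FreeAbelianGroup.of (f.hom x))) (by
      refine (iCycles_selfBraidingCycles H _).trans (Eq.trans (Subtype.ext ?_)
        (congr_arg ((functorA2.map f).f 3) (iCycles_selfBraidingCycles G _)).symm)
      change (selfBraiding H (FreeAbelianGroup.of (f.hom x)) : Words H) =
        wordsMap f.hom (selfBraiding G (FreeAbelianGroup.of x))
      simp [selfBraiding_of])
  refine (congr_arg (gammaToHomology H) (gammaMap_gamma f.hom x)).trans (e₁.trans ?_)
  exact (Eq.trans (congr_arg ((homology2ab 3).map f) e₂) e₃).symm

/-- The natural isomorphism `Γ(G) ≅ H₃(A(G,2))`. -/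
noncomputable def gammaIsoHomology : gammaFunctor.{u} ≅ homology2ab.{u} 3 :=
  NatIso.ofComponents
    (fun G =>
      haveI := (ConcreteCategory.isIso_iff_bijective (gammaToHomology G)).2
        ⟨gammaToHomology_injective G, gammaToHomology_surjective G⟩
      asIso (gammaToHomology G))
    gammaToHomology_naturality

end Comparison

end EilenbergMacLane

/-- For abelian groups `G`, there is an isomorphism `Γ(G) ≅ (H_{2-ab})₃(G, ℤ)`
which is natural in `G`. -/
theorem mainTheorem7 :
    Nonempty (EilenbergMacLane.gammaFunctor.{u} ≅ EilenbergMacLane.homology2ab.{u} 3) :=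
  ⟨EilenbergMacLane.gammaIsoHomology⟩
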